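/- Let $\mathbb B_n$ be the open unit ball of $\mathbb C^n$ (Euclidean norm $\|\cdot\|$), and let $$H_z(u,\bar u)=\frac{(1-\|z\|^2)\|u\|^2+|\langle z,u\rangle|^2}{(1-\|z\|^2)^2}\qquad(z\in\mathbb B_n,\ u\in\mathbb C^n)$$ be its Bergman metric, normalized so that $H_0(u,\bar u)=\|u\|^2$. For $f:\mathbb B_n\to\mathbb C$ holomorphic put $$Q_f(z)=\sup_{u\in\mathbb C^n\setminus\{0\}}\frac{\left|\sum_{k=1}^n\frac{\partial f}{\partial z_k}(z)\,u_k\right|}{H_z(u,\bar u)^{1/2}},\qquad \beta_f=\sup_{z\in\mathbb B_n}Q_f(z).$$ The Bloch space $\mathcal B(\mathbb B_n)$ consists of the holomorphic $f:\mathbb B_n\to\mathbb C$ with $\beta_f<\infty$, with norm $\|f\|_{\mathcal B}=|f(0)|+\beta_f$. Let $\psi$ be a holomorphic function on $\mathbb B_n$ and $\varphi$ a holomorphic self-map of $\mathbb B_n$, let $W_{\psi,\varphi}f=\psi\,(f\circ\varphi)$, and define, for $z\in\mathbb B_n$, $$\omega(z)=\sup\{|f(z)|: f\in\mathcal B(\mathbb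 B_n),\ f(0)=0,\ \|f\|_{\mathcal B}\le 1\},\qquad T_\varphi(z)=\sup\{Q_{f\circ\varphi}(z): f\in\mathcal B(\mathbb B_n),\ \beta_f\le 1\},$$ $$\sigma_{\psi,\varphi}=\sup_{z\in\mathbb B_n}\omega(\varphi(z))\,Q_\psi(z),\qquad \tau_{\psi,\varphi}=\sup_{z\in\mathbb B_n}|\psi(z)|\,T_\varphi(z).$$ Then: (a) $W_{\psi,\varphi}$ is bounded on $\mathcal B(\mathbb B_n)$ (that is, it is a bounded linear operator from $\mathcal B(\mathbb B_n)$ into itself) if and only if $\psi\in\mathcal B(\mathbb B_n)$ and $\sigma_{\psi,\varphi}$ and $\tau_{\psi,\varphi}$ are finite. (b) If $W_{\psi,\varphi}$ is bounded on $\mathcal B(\mathbb B_n)$, then it is compact on $\mathcal B(\mathbb B_n)$ if and only if $$\lim_{\|\varphi(z)\|\to1}|\psi(z)|\,T_\varphi(z)=0\quad\text{and}\quad \lim_{\|\varphi(z)\|\to1}Q_\psi(z)\log\frac{1+\|\varphi(z)\|}{1-\|\varphi(z)\|}=0,$$ where $\lim_{\|\varphi(z)\|\to1}g(z)=0$ means: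 for every $\varepsilon>0$ there is $r<1$ such that $|g(z)|<\varepsilon$ for all $z\in\mathbb B_n$ with $\|\varphi(z)\|>r$ (vacuously true if $\sup_{z\in\mathbb B_n}\|\varphi(z)\|<1$). -/

import Mathlib

open Filter Topology
open scoped ENNReal

noncomputable section

namespace BlochBall

/-- The space `ℂⁿ` with its Euclidean norm. -/
abbrev Cn (n : ℕ) : Type := EuclideanSpace ℂ (Fin n)

/-- The open unit ball `𝔹ₙ` of `ℂⁿ`. -/
abbrev unitBall (n : ℕ) : Set (Cn n) := Metric.ball 0 1

/-- The Bergman metric `H_z(u, ū)` of the unit ball, normalized so that `H_0(u, ū) = ‖u‖²`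
(equivalently, so that the distance from `0` to `z` is `(1/2) log ((1 + ‖z‖) / (1 - ‖z‖))`). -/
def bergmanForm {n : ℕ} (z u : Cn n) : ℝ :=
  ((1 - ‖z‖ ^ 2) * ‖u‖ ^ 2 + ‖inner ℂ z u‖ ^ 2) / (1 - ‖z‖ ^ 2) ^ 2

/-- `Q_f(z) = sup_{u ≠ 0} |(∇f)(z) u| / H_z(u, ū)^{1/2}`, where `(∇f)(z) u` is the complex
derivative of `f` at `z` in the direction `u`. For `z` in the ball it depends only on the
restriction of `f` to the ball. -/
def blochQ {n : ℕ} (f : Cn n → ℂ) (z : Cn n) : ℝ≥0∞ :=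
  ⨆ (u : Cn n) (_ : u ≠ 0), ENNReal.ofReal (‖fderiv ℂ f z u‖ / √(bergmanForm z u))

/-- The Bloch semi-norm `β_f = sup_{z ∈ 𝔹ₙ} Q_f(z)`. -/
def blochBeta {n : ℕ} (f : Cn n → ℂ) : ℝ≥0∞ :=
  ⨆ z ∈ unitBall n, blochQ f z

/-- The Bloch norm `|f(0)| + β_f`. -/
def blochNorm {n : ℕ} (f : Cn n → ℂ) : ℝ≥0∞ := ‖f 0‖ₑ + blochBeta f

/-- (The restriction to the ball of) `f` is a Bloch function: holomorphic with `β_f < ∞`. -/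
def IsBloch {n : ℕ} (f : Cn n → ℂ) : Prop :=
  DifferentiableOn ℂ f (unitBall n) ∧ blochBeta f < ∞

/-- `ω(z) = sup {|f(z)| : f ∈ 𝓑(𝔹ₙ), f(0) = 0, ‖f‖_𝓑 ≤ 1}`. -/
def omega {n : ℕ} (z : Cn n) : ℝ≥0∞ :=
  ⨆ (f : Cn n → ℂ) (_ : IsBloch f ∧ f 0 = 0 ∧ blochNorm f ≤ 1), ‖f z‖ₑ

/-- `T_φ(z) = sup {Q_{f ∘ φ}(z) : f ∈ 𝓑(𝔹ₙ), β_f ≤ 1}`. -/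
def bigT {n : ℕ} (φ : Cn n → Cn n) (z : Cn n) : ℝ≥0∞ :=
  ⨆ (f : Cn n → ℂ) (_ : IsBloch f ∧ blochBeta f ≤ 1), blochQ (f ∘ φ) z

/-- `σ_{ψ,φ} = sup_{z ∈ 𝔹ₙ} ω(φ(z)) Q_ψ(z)`. -/
def sigma {n : ℕ} (ψ : Cn n → ℂ) (φ : Cn n → Cn n) : ℝ≥0∞ :=
  ⨆ z ∈ unitBall n, omega (φ z) * blochQ ψ z

/-- `τ_{ψ,φ} = sup_{z ∈ 𝔹ₙ} |ψ(z)| T_φ(z)`. -/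
def tau {n : ℕ} (ψ : Cn n → ℂ) (φ : Cn n → Cn n) : ℝ≥0∞ :=
  ⨆ z ∈ unitBall n, ‖ψ z‖ₑ * bigT φ z

/-! ### The Bloch space as a normed space -/

lemma bergmanForm_pos {n : ℕ} {z u : Cn n} (hz : z ∈ unitBall n) (hu : u ≠ 0) :
    0 < bergmanForm z u := by
  have h1 : ‖z‖ < 1 := by simpa using hz
  have h2 : 0 < 1 - ‖z‖ ^ 2 := by nlinarith [norm_nonneg z]
  have h3 : 0 < ‖u‖ := norm_pos_iff.mpr hu
  unfold bergmanForm
  positivity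

lemma blochQ_add_le {n : ℕ} {f g : Cn n → ℂ} {z : Cn n}
    (hf : DifferentiableAt ℂ f z) (hg : DifferentiableAt ℂ g z) :
    blochQ (f + g) z ≤ blochQ f z + blochQ g z := by
  refine iSup₂_le fun u hu => ?_
  refine le_trans ?_ (add_le_add
    (le_iSup₂ (f := fun (u : Cn n) (_ : u ≠ 0) =>
      ENNReal.ofReal (‖fderiv ℂ f z u‖ / √(bergmanForm z u))) u hu)
    (le_iSup₂ (f := fun (u : Cn n) (_ : u ≠ 0) =>
      ENNReal.ofReal (‖fderiv ℂ g z u‖ / √(bergmanForm z u))) u hu))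
  rw [← ENNReal.ofReal_add (by positivity) (by positivity), fderiv_add hf hg, ← add_div]
  refine ENNReal.ofReal_le_ofReal ?_
  gcongr
  exact norm_add_le _ _

lemma blochQ_smul {n : ℕ} (c : ℂ) {f : Cn n → ℂ} {z : Cn n} (hf : DifferentiableAt ℂ f z) :
    blochQ (c • f) z = ‖c‖ₑ * blochQ f z := by
  unfold blochQ
  simp_rw [ENNReal.mul_iSup]
  refine iSup_congr fun u => iSup_congr fun _ => ?_
  rw [fderiv_const_smul hf, ← ofReal_norm, ← ENNReal.ofReal_mul (norm_nonneg _)]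
  simp [mul_div_assoc]

lemma differentiableAt_of_mem {n : ℕ} {f : Cn n → ℂ} (hf : DifferentiableOn ℂ f (unitBall n))
    {z : Cn n} (hz : z ∈ unitBall n) : DifferentiableAt ℂ f z :=
  hf.differentiableAt (Metric.isOpen_ball.mem_nhds hz)

lemma blochBeta_add_le {n : ℕ} {f g : Cn n → ℂ} (hf : DifferentiableOn ℂ f (unitBall n))
    (hg : DifferentiableOn ℂ g (unitBall n)) :
    blochBeta (f + g) ≤ blochBeta f + blochBeta g := by
  refine iSup₂_le fun z hz => ?_
  refine (blochQ_add_le (differentiableAt_of_mem hf hz) (differentiableAt_of_mem hg hz)).trans ?_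
  exact add_le_add (le_iSup₂ (f := fun (z : Cn n) (_ : z ∈ unitBall n) => blochQ f z) z hz)
    (le_iSup₂ (f := fun (z : Cn n) (_ : z ∈ unitBall n) => blochQ g z) z hz)

lemma blochBeta_smul {n : ℕ} (c : ℂ) {f : Cn n → ℂ} (hf : DifferentiableOn ℂ f (unitBall n)) :
    blochBeta (c • f) = ‖c‖ₑ * blochBeta f := by
  unfold blochBeta
  simp_rw [ENNReal.mul_iSup]
  exact iSup_congr fun z => iSup_congr fun hz => blochQ_smul c (differentiableAt_of_mem hf hz)

lemma blochBeta_zero {n : ℕ} : blochBeta (0 : Cn n → ℂ) = 0 := by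
  simp [blochBeta, blochQ]

lemma eq_of_blochBeta_eq_zero {n : ℕ} {f : Cn n → ℂ} (hf : DifferentiableOn ℂ f (unitBall n))
    (h : blochBeta f = 0) {z : Cn n} (hz : z ∈ unitBall n) : f z = f 0 := by
  have hd : Set.EqOn (fderiv ℂ f) 0 (unitBall n) := by
    intro w hw
    have h1 : blochQ f w = 0 := by
      simp only [blochBeta, ENNReal.iSup_eq_zero] at h
      exact h w hw
    simp only [blochQ, ENNReal.iSup_eq_zero] at h1
    ext u
    by_cases hu : u = 0
    · simp [hu]
    · have h2 := ENNReal.ofReal_eq_zero.mp (h1 u hu)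
      have h3 : 0 < √(bergmanForm w u) := Real.sqrt_pos.mpr (bergmanForm_pos hw hu)
      have h4 : ‖fderiv ℂ f w u‖ ≤ 0 := by
        by_contra h5
        exact absurd h2 (not_le.mpr (div_pos (not_le.mp h5) h3))
      simpa using norm_le_zero_iff.mp h4
  exact Metric.isOpen_ball.is_const_of_fderiv_eq_zero
    (convex_ball (0 : Cn n) 1).isPreconnected hf hd hz (by simp)

/-- The vector space of Bloch functions on the ball. A function on the ball is represented by its
extension by `0` to all of `ℂⁿ`, so that equality of elements is equality on the ball. -/
def blochSubmodule (n : ℕ) : Submodule ℂ (Cn n → ℂ) where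
  carrier := {f | IsBloch f ∧ ∀ z, z ∉ unitBall n → f z = 0}
  zero_mem' := ⟨⟨differentiableOn_const 0, by simp [blochBeta_zero]⟩, fun _ _ => rfl⟩
  add_mem' := by
    rintro f g ⟨⟨hf, hf'⟩, hf0⟩ ⟨⟨hg, hg'⟩, hg0⟩
    exact ⟨⟨hf.add hg, (blochBeta_add_le hf hg).trans_lt (ENNReal.add_lt_top.mpr ⟨hf', hg'⟩)⟩,
      fun z hz => by simp [hf0 z hz, hg0 z hz]⟩
  smul_mem' := by
    rintro c f ⟨⟨hf, hf'⟩, hf0⟩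
    exact ⟨⟨hf.const_smul c, by
        rw [blochBeta_smul c hf]; exact ENNReal.mul_lt_top enorm_lt_top hf'⟩,
      fun z hz => by simp [hf0 z hz]⟩

/-- The Bloch space `𝓑(𝔹ₙ)`, a type of its own so that it carries only the topology of the
Bloch norm (and not that of pointwise convergence). -/
def BlochSpace (n : ℕ) : Type := blochSubmodule n

instance (n : ℕ) : AddCommGroup (BlochSpace n) := inferInstanceAs (AddCommGroup (blochSubmodule n))

instance (n : ℕ) : Module ℂ (BlochSpace n) := inferInstanceAs (Module ℂ (blochSubmodule n))

instance (n : ℕ) : CoeFun (BlochSpace n) (fun _ => Cn n → ℂ) := ⟨fun f => f.1⟩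

/-- The Bloch norm on the Bloch space. -/
instance (n : ℕ) : NormedAddCommGroup (BlochSpace n) :=
  AddGroupNorm.toNormedAddCommGroup
    { toFun := fun f => (blochNorm f.1).toReal
      map_zero' := by
        change (blochNorm (0 : Cn n → ℂ)).toReal = 0
        simp [blochNorm, blochBeta_zero]
      add_le' := by
        intro f g
        change (blochNorm (f.1 + g.1)).toReal ≤ _
        have hf : blochNorm f.1 ≠ ∞ := ENNReal.add_ne_top.mpr ⟨enorm_ne_top, f.2.1.2.ne⟩
        have hg : blochNorm g.1 ≠ ∞ := ENNReal.add_ne_top.mpr ⟨enorm_ne_top, g.2.1.2.ne⟩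
        rw [← ENNReal.toReal_add hf hg]
        refine ENNReal.toReal_mono (ENNReal.add_ne_top.mpr ⟨hf, hg⟩) ?_
        refine (add_le_add (enorm_add_le (f.1 0) (g.1 0))
          (blochBeta_add_le f.2.1.1 g.2.1.1)).trans (le_of_eq ?_)
        unfold blochNorm
        ring
      neg' := by
        intro f
        change (blochNorm (-f.1)).toReal = _
        have : -f.1 = (-1 : ℂ) • f.1 := by simp
        simp only [blochNorm]
        rw [this, blochBeta_smul _ f.2.1.1]
        simp
      eq_zero_of_map_eq_zero' := by
        intro f hf
        have hf' : blochNorm f.1 ≠ ∞ := ENNReal.add_ne_top.mpr ⟨enorm_ne_top, f.2.1.2.ne⟩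
        have h0 : blochNorm f.1 = 0 := ((ENNReal.toReal_eq_zero_iff _).mp hf).resolve_right hf'
        obtain ⟨h1, h2⟩ := add_eq_zero.mp h0
        refine Subtype.ext (funext fun z => ?_)
        change f.1 z = 0
        by_cases hz : z ∈ unitBall n
        · rw [eq_of_blochBeta_eq_zero f.2.1.1 h2 hz]
          simpa using h1
        · exact f.2.2 z hz }

lemma BlochSpace.norm_def {n : ℕ} (f : BlochSpace n) : ‖f‖ = (blochNorm f).toReal := rfl

instance (n : ℕ) : NormedSpace ℂ (BlochSpace n) where
  norm_smul_le c f := by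
    change (blochNorm (c • f.1)).toReal ≤ ‖c‖ * (blochNorm f.1).toReal
    simp only [blochNorm]
    rw [blochBeta_smul c f.2.1.1, Pi.smul_apply, enorm_smul, ← mul_add, ENNReal.toReal_mul]
    simp

/-- The continuous linear operator `T` on the Bloch space is the weighted composition operator
`W_{ψ,φ} f = ψ (f ∘ φ)`. -/
def IsWeightedComp {n : ℕ} (ψ : Cn n → ℂ) (φ : Cn n → Cn n)
    (T : BlochSpace n →L[ℂ] BlochSpace n) : Prop :=
  ∀ f : BlochSpace n, ∀ z ∈ unitBall n, T f z = ψ z * f (φ z)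

/-- `W_{ψ,φ}` is bounded on the Bloch space: it maps the Bloch space into itself, and it is a
bounded (i.e. continuous) linear operator there. -/
def IsBoundedWeightedComp {n : ℕ} (ψ : Cn n → ℂ) (φ : Cn n → Cn n) : Prop :=
  ∃ T : BlochSpace n →L[ℂ] BlochSpace n, IsWeightedComp ψ φ T

/-- The filter on the ball along which `‖φ(z)‖ → 1`. It is trivial if `‖φ‖` is bounded away
from `1`; limits along it are then vacuous, as usual. -/
def boundaryFilter {n : ℕ} (φ : Cn n → Cn n) : Filter (Cn n) :=
  comap (fun z => ‖φ z‖) (𝓝[<] 1) ⊓ 𝓟 (unitBall n)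

end BlochBall

end

/-! By the product rule, the derivative of ψ·(f ∘ φ) at z in the direction u is ψ(z)
f'(φ(z))(φ'(z)u) + f(φ(z)) ψ'(z)u. The first term is governed by |ψ| T_φ. Writing f(φ(z)) = f(0) +
(f(φ(z)) - f(0)), the second is governed by β_ψ and ω(φ) Q_ψ. This is sufficiency in (a).

Necessity uses test functions centred at w = φ(z), with Bloch norms bounded independently of w.
`testRadial` and `testTangential` vanish at w, so only the first term survives, and their gradients
there recover the two parts of the Bergman length (`bergmanNorm_le_tests`); this bounds |ψ| T_φ.
With the first term controlled, `testLog`, whose value at w has the size of log(1/(1 - ‖w‖)) near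
the sphere, bounds ω(φ) Q_ψ. The seminorm estimates rest on the fact that z + cu stays in the ball
for |c| ≤ 1/(3 H_z(u,ū)^{1/2}) (`add_smul_mem_unitBall`), combined with Cauchy's estimate for the
bounded tests and with positivity of Re(1 - ⟨x, w⟩) for the logarithmic one. Sharp constants never
matter.

For (b), compactness is tested on bounded families tending to 0 pointwise. A compact T makes their
images tend to 0 in norm, because a norm cluster point is determined by its values. The test
functions form such families as ‖φ(z)‖ → 1, so the estimates of (a) yield the two limits.
Conversely, the limits control the region ‖φ(z)‖ > r. On ‖φ(z)‖ ≤ r the functions and their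
gradients are uniformly small, and φ' is controlled by T_φ (`bergmanNorm_le_bigT`). Compactness then
follows from `exists_bloch_limit`, a Montel argument along ultrafilters. -/

namespace BlochBall

/-! ### The Bergman norm -/

/-- The Bergman length `H_z(u, ū)^{1/2}`. -/
noncomputable def bergmanNorm {n : ℕ} (z u : Cn n) : ℝ := √(bergmanForm z u)

variable {n : ℕ}

lemma norm_lt_one_of_mem {z : Cn n} (hz : z ∈ unitBall n) : ‖z‖ < 1 := by simpa using hz

lemma one_sub_norm_sq_pos {z : Cn n} (hz : z ∈ unitBall n) : 0 < 1 - ‖z‖ ^ 2 := by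
  nlinarith [norm_nonneg z, norm_lt_one_of_mem hz]

lemma bergmanNorm_nonneg (z u : Cn n) : 0 ≤ bergmanNorm z u := Real.sqrt_nonneg _

lemma bergmanNorm_pos {z u : Cn n} (hz : z ∈ unitBall n) (hu : u ≠ 0) : 0 < bergmanNorm z u :=
  Real.sqrt_pos.mpr (bergmanForm_pos hz hu)

lemma bergmanForm_nonneg {z : Cn n} (hz : z ∈ unitBall n) (u : Cn n) : 0 ≤ bergmanForm z u := by
  have := one_sub_norm_sq_pos hz
  unfold bergmanForm
  positivity

lemma bergmanNorm_sq_mul {z : Cn n} (hz : z ∈ unitBall n) (u : Cn n) :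
    bergmanNorm z u ^ 2 * (1 - ‖z‖ ^ 2) ^ 2
      = (1 - ‖z‖ ^ 2) * ‖u‖ ^ 2 + ‖inner ℂ z u‖ ^ 2 := by
  have := one_sub_norm_sq_pos hz
  rw [bergmanNorm, Real.sq_sqrt (bergmanForm_nonneg hz u), bergmanForm]
  field_simp

lemma norm_le_bergmanNorm {z : Cn n} (hz : z ∈ unitBall n) (u : Cn n) :
    ‖u‖ ≤ bergmanNorm z u := by
  have hA := one_sub_norm_sq_pos hz
  refine Real.le_sqrt_of_sq_le ?_
  rw [bergmanForm, le_div_iff₀ (by positivity)]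
  have h1 : 1 - ‖z‖ ^ 2 ≤ 1 := by nlinarith [sq_nonneg ‖z‖]
  have h2 : (1 - ‖z‖ ^ 2) ^ 2 ≤ 1 - ‖z‖ ^ 2 := by nlinarith
  nlinarith [sq_nonneg ‖inner ℂ z u‖, mul_le_mul_of_nonneg_left h2 (sq_nonneg ‖u‖)]

lemma bergmanNorm_le {z : Cn n} (hz : z ∈ unitBall n) (u : Cn n) :
    bergmanNorm z u ≤ ‖u‖ / (1 - ‖z‖ ^ 2) := by
  have hA := one_sub_norm_sq_pos hz
  refine Real.sqrt_le_iff.mpr ⟨by positivity, ?_⟩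
  rw [bergmanForm, div_pow]
  gcongr
  have h1 : ‖inner ℂ z u‖ ^ 2 ≤ (‖z‖ * ‖u‖) ^ 2 := by
    gcongr
    exact norm_inner_le_norm z u
  nlinarith

/-- The form is a sum of two squares and √(a² + b²) ≤ a + b. Each summand is the gradient of one of
the two bounded test functions. -/
lemma bergmanNorm_le_add {z : Cn n} (hz : z ∈ unitBall n) (u : Cn n) :
    bergmanNorm z u ≤ ‖u‖ / √(1 - ‖z‖ ^ 2) + ‖inner ℂ z u‖ / (1 - ‖z‖ ^ 2) := by
  have hA := one_sub_norm_sq_pos hz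
  refine Real.sqrt_le_iff.mpr ⟨by positivity, ?_⟩
  have h1 : bergmanForm z u
      = (‖u‖ / √(1 - ‖z‖ ^ 2)) ^ 2 + (‖inner ℂ z u‖ / (1 - ‖z‖ ^ 2)) ^ 2 := by
    rw [bergmanForm, div_pow, Real.sq_sqrt hA.le]
    field_simp
  have h2 : 0 ≤ ‖u‖ / √(1 - ‖z‖ ^ 2) * (‖inner ℂ z u‖ / (1 - ‖z‖ ^ 2)) := by positivity
  rw [h1]
  nlinarith

/-- The discs of Bergman radius comparable to one around `z` stay in the ball. -/
lemma add_smul_mem_unitBall {z u : Cn n} (hz : z ∈ unitBall n) {c : ℂ}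
    (hc : ‖c‖ * (3 * bergmanNorm z u) ≤ 1) : z + c • u ∈ unitBall n := by
  have hA := one_sub_norm_sq_pos hz
  have hs := bergmanNorm_sq_mul hz u
  have hh := bergmanNorm_nonneg z u
  set h := bergmanNorm z u
  set A := 1 - ‖z‖ ^ 2 with hAdef
  -- Both terms on the right of `hs` are nonnegative, so each is at most h²A².
  have hb : ‖inner ℂ z u‖ ≤ h * A := by
    refine abs_le_of_sq_le_sq' ?_ (by positivity) |>.2
    nlinarith [mul_nonneg hA.le (sq_nonneg ‖u‖)]
  have hU : ‖u‖ ^ 2 ≤ h ^ 2 * A := by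
    have : A * ‖u‖ ^ 2 ≤ A * (h ^ 2 * A) := by nlinarith [sq_nonneg ‖inner ℂ z u‖]
    exact le_of_mul_le_mul_left this hA
  have h1 : ‖z + c • u‖ ^ 2 ≤ ‖z‖ ^ 2 + 2 * (‖c‖ * ‖inner ℂ z u‖) + ‖c‖ ^ 2 * ‖u‖ ^ 2 := by
    rw [norm_add_sq (𝕜 := ℂ), norm_smul, mul_pow]
    have : RCLike.re (inner ℂ z (c • u)) ≤ ‖c‖ * ‖inner ℂ z u‖ := by
      rw [← norm_mul, ← inner_smul_right]
      exact RCLike.re_le_norm _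
    linarith
  have hch : ‖c‖ * h ≤ 1 / 3 := by linarith
  have hch0 : 0 ≤ ‖c‖ * h := by positivity
  have h2 : ‖c‖ * ‖inner ℂ z u‖ ≤ 1 / 3 * A := by
    calc ‖c‖ * ‖inner ℂ z u‖ ≤ ‖c‖ * (h * A) := by gcongr
      _ = ‖c‖ * h * A := by ring
      _ ≤ _ := by gcongr
  have h3 : ‖c‖ ^ 2 * ‖u‖ ^ 2 ≤ 1 / 9 * A := by
    calc ‖c‖ ^ 2 * ‖u‖ ^ 2 ≤ ‖c‖ ^ 2 * (h ^ 2 * A) := by gcongr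
      _ = (‖c‖ * h) ^ 2 * A := by ring
      _ ≤ (1 / 3) ^ 2 * A := by gcongr
      _ = _ := by norm_num
  -- The increment of ‖z‖² is at most (2/3 + 1/9)A, less than A = 1 - ‖z‖².
  have h4 : ‖z + c • u‖ ^ 2 < 1 := by linarith
  simpa using (sq_lt_one_iff₀ (norm_nonneg _)).mp h4

/-! ### Cauchy estimates -/

/-- Cauchy's estimate in one variable, on the slice c ↦ f(z + cu). The radius is left free so that
it can be fitted to the Bergman or to the Euclidean length of u. -/
lemma norm_fderiv_apply_le_of_disc {f : Cn n → ℂ} {z u : Cn n} {M r : ℝ} (hr : 0 < r)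
    (hd : ∀ c : ℂ, ‖c‖ ≤ r → DifferentiableAt ℂ f (z + c • u) ∧ ‖f (z + c • u)‖ ≤ M) :
    ‖fderiv ℂ f z u‖ ≤ M / r := by
  have hline : ∀ c : ℂ, HasDerivAt (fun c : ℂ => z + c • u) u c := fun c => by
    simpa using ((hasDerivAt_id c).smul_const u).const_add z
  have hderiv : ∀ c : ℂ, ‖c‖ ≤ r →
      HasDerivAt (fun c : ℂ => f (z + c • u)) (fderiv ℂ f (z + c • u) u) c := fun c hc =>
    (hd c hc).1.hasFDerivAt.comp_hasDerivAt c (hline c)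
  have h0 := (hderiv 0 (by simpa using hr.le)).deriv
  simp only [zero_smul, add_zero] at h0
  rw [← h0]
  refine Complex.norm_deriv_le_of_forall_mem_sphere_norm_le hr ?_ ?_
  · refine DifferentiableOn.diffContOnCl fun c hc => ?_
    rw [closure_ball _ hr.ne'] at hc
    exact (hderiv c (by simpa using hc)).differentiableAt.differentiableWithinAt
  · intro c hc
    exact (hd c (by simpa using (mem_sphere_zero_iff_norm.mp hc).le)).2

/-- The slice disc of radius 1/(3 · Bergman length) lies in the ball. Hence bounded functions are
Bloch, with a seminorm bound independent of where they concentrate. -/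
lemma norm_fderiv_le_of_bounded {f : Cn n → ℂ} (hf : DifferentiableOn ℂ f (unitBall n)) {M : ℝ}
    (hM : ∀ z ∈ unitBall n, ‖f z‖ ≤ M) {z : Cn n} (hz : z ∈ unitBall n) (u : Cn n) :
    ‖fderiv ℂ f z u‖ ≤ 3 * M * bergmanNorm z u := by
  by_cases hu : u = 0
  · simp only [hu, map_zero, norm_zero]
    have := (norm_nonneg _).trans (hM z hz)
    have := bergmanNorm_nonneg z (0 : Cn n)
    positivity
  have hh := bergmanNorm_pos hz hu
  have := norm_fderiv_apply_le_of_disc (z := z) (u := u) (M := M) (r := 1 / (3 * bergmanNorm z u))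
    (by positivity) (fun c hc => by
      have h1 : z + c • u ∈ unitBall n :=
        add_smul_mem_unitBall hz ((le_div_iff₀ (by positivity)).mp hc)
      exact ⟨differentiableAt_of_mem hf h1, hM _ h1⟩)
  calc _ ≤ _ := this
    _ = _ := by field_simp

/-- Cauchy estimate on a Euclidean ball. -/
lemma norm_fderiv_apply_le_of_ball {f : Cn n → ℂ} (hf : DifferentiableOn ℂ f (unitBall n))
    {M r s : ℝ} (hrs : r < s) (hs : s < 1) (hM : ∀ x : Cn n, ‖x‖ ≤ s → ‖f x‖ ≤ M)
    {x : Cn n} (hx : ‖x‖ ≤ r) (u : Cn n) :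
    ‖fderiv ℂ f x u‖ ≤ M / (s - r) * ‖u‖ := by
  by_cases hu : u = 0
  · simp [hu]
  have hu' : 0 < ‖u‖ := norm_pos_iff.mpr hu
  have hsr : 0 < s - r := by linarith
  have := norm_fderiv_apply_le_of_disc (z := x) (u := u) (M := M) (r := (s - r) / ‖u‖)
    (by positivity) (fun c hc => by
      have h1 : ‖x + c • u‖ ≤ s := by
        have h2 := (le_div_iff₀ hu').mp hc
        calc _ ≤ ‖x‖ + ‖c • u‖ := norm_add_le _ _
          _ ≤ s := by rw [norm_smul]; linarith
      exact ⟨differentiableAt_of_mem hf (by simpa using h1.trans_lt hs), hM _ h1⟩)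
  calc _ ≤ _ := this
    _ = _ := by field_simp

/-! ### Real-valued forms of the Bloch semi-norm -/

lemma blochQ_le_iff {f : Cn n → ℂ} {z : Cn n} (hz : z ∈ unitBall n) {c : ℝ} (hc : 0 ≤ c) :
    blochQ f z ≤ ENNReal.ofReal c ↔ ∀ u, ‖fderiv ℂ f z u‖ ≤ c * bergmanNorm z u := by
  simp only [blochQ, iSup_le_iff, ENNReal.ofReal_le_ofReal_iff hc]
  constructor
  · intro h u
    by_cases hu : u = 0
    · simp [hu, bergmanNorm, bergmanForm]
    · exact (div_le_iff₀ (bergmanNorm_pos hz hu)).mp (h u hu)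
  · intro h u hu
    exact (div_le_iff₀ (bergmanNorm_pos hz hu)).mpr (h u)

lemma blochBeta_le_iff {f : Cn n → ℂ} {c : ℝ} (hc : 0 ≤ c) :
    blochBeta f ≤ ENNReal.ofReal c ↔
      ∀ z ∈ unitBall n, ∀ u, ‖fderiv ℂ f z u‖ ≤ c * bergmanNorm z u := by
  simp only [blochBeta, iSup_le_iff]
  exact forall₂_congr fun z hz => blochQ_le_iff hz hc

lemma isBloch_of_le {f : Cn n → ℂ} (hf : DifferentiableOn ℂ f (unitBall n)) {c : ℝ} (hc : 0 ≤ c)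
    (h : ∀ z ∈ unitBall n, ∀ u, ‖fderiv ℂ f z u‖ ≤ c * bergmanNorm z u) : IsBloch f :=
  ⟨hf, ((blochBeta_le_iff hc).mpr h).trans_lt ENNReal.ofReal_lt_top⟩

lemma IsBloch.norm_fderiv_le {f : Cn n → ℂ} (hf : IsBloch f) {z : Cn n} (hz : z ∈ unitBall n)
    (u : Cn n) : ‖fderiv ℂ f z u‖ ≤ (blochBeta f).toReal * bergmanNorm z u :=
  (blochBeta_le_iff ENNReal.toReal_nonneg).mp (ENNReal.ofReal_toReal hf.2.ne).ge z hz u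

/-! ### Growth of Bloch functions -/

/-- The hyperbolic size `log ((1 + t) / (1 - t))` is nonnegative. -/
lemma log_div_nonneg {t : ℝ} (h0 : 0 ≤ t) (h1 : t < 1) : 0 ≤ Real.log ((1 + t) / (1 - t)) := by
  refine Real.log_nonneg ?_
  rw [le_div_iff₀ (by linarith)]
  linarith

/-- Along t ↦ tw the Bergman speed is at most ‖w‖/(1 - t²‖w‖²), with primitive ½ log((1 + t‖w‖)/(1 -
t‖w‖)). The mean value inequality compares f with it. -/
lemma norm_sub_zero_le_log {f : Cn n → ℂ} (hf : DifferentiableOn ℂ f (unitBall n)) {c : ℝ}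
    (hc : 0 ≤ c) (h : ∀ z ∈ unitBall n, ∀ u, ‖fderiv ℂ f z u‖ ≤ c * bergmanNorm z u)
    {w : Cn n} (hw : w ∈ unitBall n) :
    ‖f w - f 0‖ ≤ c * (1 / 2 * Real.log ((1 + ‖w‖) / (1 - ‖w‖))) := by
  have hw1 := norm_lt_one_of_mem hw
  have hw0 := norm_nonneg w
  have hmem : ∀ t ∈ Set.Icc (0 : ℝ) 1, t • w ∈ unitBall n := fun t ht => by
    have : ‖t • w‖ < 1 := by
      rw [norm_smul, Real.norm_of_nonneg ht.1]
      nlinarith [ht.2, ht.1]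
    simpa using this
  have hd : ∀ t ∈ Set.Icc (0 : ℝ) 1,
      HasDerivAt (fun t : ℝ => f (t • w) - f 0) (fderiv ℂ f (t • w) w) t := fun t ht => by
    have h1 : HasDerivAt (fun t : ℝ => t • w) w t := by
      simpa using (hasDerivAt_id t).smul_const w
    exact (((differentiableAt_of_mem hf (hmem t ht)).hasFDerivAt.restrictScalars
      ℝ).comp_hasDerivAt t h1).sub_const _
  have hpos : ∀ t ∈ Set.Icc (0 : ℝ) 1, 0 < 1 + t * ‖w‖ ∧ 0 < 1 - t * ‖w‖ := fun t ht =>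
    ⟨by nlinarith [ht.1], by nlinarith [ht.1, ht.2]⟩
  have hB : ∀ t ∈ Set.Icc (0 : ℝ) 1, HasDerivAt
      (fun t : ℝ => c * (1 / 2 * (Real.log (1 + t * ‖w‖) - Real.log (1 - t * ‖w‖))))
      (c * (‖w‖ / (1 - t ^ 2 * ‖w‖ ^ 2))) t := fun t ht => by
    obtain ⟨hp, hm⟩ := hpos t ht
    have h1 : HasDerivAt (fun t : ℝ => 1 + t * ‖w‖) ‖w‖ t := by
      simpa using ((hasDerivAt_id t).mul_const ‖w‖).const_add 1
    have h2 : HasDerivAt (fun t : ℝ => 1 - t * ‖w‖) (-‖w‖) t := by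
      simpa using ((hasDerivAt_id t).mul_const ‖w‖).const_sub 1
    refine ((((h1.log hp.ne').sub (h2.log hm.ne')).const_mul (1 / 2)).const_mul c).congr_deriv ?_
    have : 1 - t ^ 2 * ‖w‖ ^ 2 = (1 + t * ‖w‖) * (1 - t * ‖w‖) := by ring
    rw [this, div_sub_div _ _ hp.ne' hm.ne']
    ring
  have key := image_norm_le_of_norm_deriv_right_le_deriv_boundary' (a := 0) (b := 1)
    (f := fun t : ℝ => f (t • w) - f 0) (f' := fun t => fderiv ℂ f (t • w) w)
    (fun t ht => (hd t ht).continuousAt.continuousWithinAt)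
    (fun t ht => (hd t (Set.Ico_subset_Icc_self ht)).hasDerivWithinAt)
    (B := fun t : ℝ => c * (1 / 2 * (Real.log (1 + t * ‖w‖) - Real.log (1 - t * ‖w‖))))
    (B' := fun t => c * (‖w‖ / (1 - t ^ 2 * ‖w‖ ^ 2))) (by simp)
    (fun t ht => (hB t ht).continuousAt.continuousWithinAt)
    (fun t ht => (hB t (Set.Ico_subset_Icc_self ht)).hasDerivWithinAt)
    (fun t ht => by
      have ht' := Set.Ico_subset_Icc_self ht
      refine (h _ (hmem t ht') w).trans ?_
      gcongr
      refine (bergmanNorm_le (hmem t ht') w).trans (le_of_eq ?_)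
      rw [norm_smul, Real.norm_of_nonneg ht.1, mul_pow])
    (Set.right_mem_Icc.mpr zero_le_one)
  simp only [one_smul, one_mul] at key
  rwa [Real.log_div (by positivity) (by linarith)]

lemma norm_fderiv_le_of_bergman {f : Cn n → ℂ} {c : ℝ}
    (hc : 0 ≤ c) (h : ∀ z ∈ unitBall n, ∀ u, ‖fderiv ℂ f z u‖ ≤ c * bergmanNorm z u)
    {r : ℝ} (hr : r < 1) {w : Cn n} (hw : ‖w‖ ≤ r) :
    ‖fderiv ℂ f w‖ ≤ c / (1 - r ^ 2) := by
  have hwm : w ∈ unitBall n := by simpa using hw.trans_lt hr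
  have hr0 : 0 ≤ r := (norm_nonneg w).trans hw
  have hA : 0 < 1 - r ^ 2 := by nlinarith
  refine ContinuousLinearMap.opNorm_le_bound _ (by positivity) fun u => ?_
  calc _ ≤ c * bergmanNorm w u := h w hwm u
    _ ≤ c * (‖u‖ / (1 - ‖w‖ ^ 2)) := by gcongr; exact bergmanNorm_le hwm u
    _ ≤ c * (‖u‖ / (1 - r ^ 2)) := by gcongr
    _ = _ := by ring

lemma norm_sub_le_of_bergman {f : Cn n → ℂ} (hf : DifferentiableOn ℂ f (unitBall n)) {c : ℝ}
    (hc : 0 ≤ c) (h : ∀ z ∈ unitBall n, ∀ u, ‖fderiv ℂ f z u‖ ≤ c * bergmanNorm z u)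
    {r : ℝ} (hr : r < 1) {x y : Cn n} (hx : ‖x‖ ≤ r) (hy : ‖y‖ ≤ r) :
    ‖f y - f x‖ ≤ c / (1 - r ^ 2) * ‖y - x‖ := by
  refine (convex_closedBall (0 : Cn n) r).norm_image_sub_le_of_norm_fderiv_le (𝕜 := ℂ)
    (fun z hz => differentiableAt_of_mem hf ?_)
    (fun z hz => norm_fderiv_le_of_bergman hc h hr (by simpa using hz))
    (by simpa using hx) (by simpa using hy)
  have : ‖z‖ ≤ r := by simpa using hz
  simpa using this.trans_lt hr

/-! ### Elements of the Bloch space -/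

namespace BlochSpace

lemma norm_eq (f : BlochSpace n) : ‖f‖ = ‖f 0‖ + (blochBeta f.1).toReal := by
  rw [norm_def, blochNorm, ENNReal.toReal_add enorm_ne_top f.2.1.2.ne, toReal_enorm]

lemma differentiableOn (f : BlochSpace n) : DifferentiableOn ℂ f (unitBall n) := f.2.1.1

lemma norm_fderiv_le (f : BlochSpace n) {z : Cn n} (hz : z ∈ unitBall n) (u : Cn n) :
    ‖fderiv ℂ f z u‖ ≤ ‖f‖ * bergmanNorm z u := by
  refine (f.2.1.norm_fderiv_le hz u).trans ?_
  gcongr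
  · exact bergmanNorm_nonneg z u
  · rw [norm_eq]
    linarith [norm_nonneg (f 0)]

lemma norm_apply_zero_le (f : BlochSpace n) : ‖f 0‖ ≤ ‖f‖ := by
  rw [norm_eq]
  linarith [ENNReal.toReal_nonneg (a := blochBeta f.1)]

lemma norm_le_add (f : BlochSpace n) {a b : ℝ} (ha : ‖f 0‖ ≤ a) (hb : 0 ≤ b)
    (h : ∀ z ∈ unitBall n, ∀ u, ‖fderiv ℂ f z u‖ ≤ b * bergmanNorm z u) : ‖f‖ ≤ a + b := by
  rw [norm_eq]
  gcongr
  exact ENNReal.toReal_le_of_le_ofReal hb ((blochBeta_le_iff hb).mpr h)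

lemma ext_ball {f g : BlochSpace n} (h : ∀ z ∈ unitBall n, f z = g z) : f = g := by
  refine Subtype.ext (funext fun z => ?_)
  by_cases hz : z ∈ unitBall n
  · exact h z hz
  · exact (f.2.2 z hz).trans (g.2.2 z hz).symm

lemma norm_sub_zero_le (f : BlochSpace n) {w : Cn n} (hw : w ∈ unitBall n) :
    ‖f w - f 0‖ ≤ ‖f‖ * (1 / 2 * Real.log ((1 + ‖w‖) / (1 - ‖w‖))) :=
  norm_sub_zero_le_log f.differentiableOn (norm_nonneg f) (fun _ hz u => f.norm_fderiv_le hz u) hw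

lemma norm_apply_le (f : BlochSpace n) {w : Cn n} (hw : w ∈ unitBall n) :
    ‖f w‖ ≤ (1 + 1 / 2 * Real.log ((1 + ‖w‖) / (1 - ‖w‖))) * ‖f‖ := by
  have h1 := f.norm_sub_zero_le hw
  have h2 := f.norm_apply_zero_le
  have h3 := norm_le_norm_add_norm_sub (f 0) (f w)
  rw [norm_sub_rev] at h3
  linarith

lemma add_apply (f g : BlochSpace n) (z : Cn n) : (f + g) z = f z + g z := rfl
lemma sub_apply (f g : BlochSpace n) (z : Cn n) : (f - g) z = f z - g z := rfl
lemma smul_apply (c : ℂ) (f : BlochSpace n) (z : Cn n) : (c • f) z = c * f z := rfl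

/-- Evaluation at a point of the ball. -/
noncomputable def eval (w : Cn n) (hw : w ∈ unitBall n) : BlochSpace n →L[ℂ] ℂ :=
  LinearMap.mkContinuous
    { toFun := fun f => f w
      map_add' := fun f g => add_apply f g w
      map_smul' := fun c f => smul_apply c f w }
    (1 + 1 / 2 * Real.log ((1 + ‖w‖) / (1 - ‖w‖))) (fun f => f.norm_apply_le hw)

open Classical in
/-- The element of the Bloch space given by a Bloch function (and zero otherwise). -/
noncomputable def mk (f : Cn n → ℂ) : BlochSpace n :=
  if h : IsBloch ((unitBall n).indicator f) then
    ⟨(unitBall n).indicator f, h, fun _ hz => Set.indicator_of_notMem hz f⟩ else 0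

lemma indicator_eventuallyEq (f : Cn n → ℂ) {z : Cn n} (hz : z ∈ unitBall n) :
    (unitBall n).indicator f =ᶠ[𝓝 z] f :=
  (Metric.isOpen_ball.eventually_mem hz).mono fun _ hx => Set.indicator_of_mem hx f

lemma isBloch_indicator {f : Cn n → ℂ} (hf : IsBloch f) : IsBloch ((unitBall n).indicator f) := by
  refine isBloch_of_le (hf.1.congr fun z hz => Set.indicator_of_mem hz f)
    (c := (blochBeta f).toReal) ENNReal.toReal_nonneg fun z hz u => ?_
  rw [(indicator_eventuallyEq f hz).fderiv_eq]
  exact hf.norm_fderiv_le hz u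

lemma mk_apply {f : Cn n → ℂ} (hf : IsBloch f) {z : Cn n} (hz : z ∈ unitBall n) :
    mk f z = f z := by
  have h : mk f = (⟨(unitBall n).indicator f, isBloch_indicator hf,
      fun _ hx => Set.indicator_of_notMem hx f⟩ : blochSubmodule n) :=
    dif_pos (isBloch_indicator hf)
  rw [h]
  exact Set.indicator_of_mem hz f

lemma fderiv_eq_of_eqOn {f g : Cn n → ℂ} (h : ∀ x ∈ unitBall n, f x = g x) {z : Cn n}
    (hz : z ∈ unitBall n) : fderiv ℂ f z = fderiv ℂ g z :=
  Filter.EventuallyEq.fderiv_eq ((Metric.isOpen_ball.eventually_mem hz).mono h)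

lemma norm_mk_le {f : Cn n → ℂ} (hf : DifferentiableOn ℂ f (unitBall n)) {a b : ℝ}
    (ha : ‖f 0‖ ≤ a) (hb : 0 ≤ b)
    (h : ∀ z ∈ unitBall n, ∀ u, ‖fderiv ℂ f z u‖ ≤ b * bergmanNorm z u) : ‖mk f‖ ≤ a + b := by
  have hB := isBloch_of_le hf hb h
  refine norm_le_add _ ?_ hb fun z hz u => ?_
  · rwa [mk_apply hB (by simp)]
  · rw [fderiv_eq_of_eqOn (fun x hx => mk_apply hB hx) hz]
    exact h z hz u

end BlochSpace

/-! ### The kernel `1 - ⟨x, w⟩` -/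

section Kernel

variable {w x : Cn n}

lemma norm_inner_lt_one (hw : w ∈ unitBall n) (hx : x ∈ unitBall n) : ‖inner ℂ w x‖ < 1 := by
  have h1 := norm_lt_one_of_mem hw
  have h2 := norm_lt_one_of_mem hx
  nlinarith [norm_inner_le_norm (𝕜 := ℂ) w x, norm_nonneg w, norm_nonneg x]

lemma re_kernel_pos (hw : w ∈ unitBall n) (hx : x ∈ unitBall n) :
    0 < (1 - inner ℂ w x).re := by
  have h1 := norm_inner_lt_one hw hx
  have h2 := Complex.re_le_norm (inner ℂ w x)
  simp only [Complex.sub_re, Complex.one_re]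
  linarith

lemma kernel_ne_zero (hw : w ∈ unitBall n) (hx : x ∈ unitBall n) : 1 - inner ℂ w x ≠ 0 := by
  intro h
  have := re_kernel_pos hw hx
  simp [h] at this

lemma one_sub_norm_le_kernel_left (w : Cn n) (hx : x ∈ unitBall n) :
    1 - ‖w‖ ≤ ‖1 - inner ℂ w x‖ := by
  have h2 := norm_lt_one_of_mem hx
  have h3 := norm_sub_norm_le (1 : ℂ) (inner ℂ w x)
  rw [norm_one] at h3
  nlinarith [norm_inner_le_norm (𝕜 := ℂ) w x, norm_nonneg w]

/-- This bound does not involve w, so it keeps the kernel away from 0 at a fixed x while w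
approaches the sphere. -/
lemma one_sub_norm_le_kernel_right (hw : w ∈ unitBall n) (x : Cn n) :
    1 - ‖x‖ ≤ ‖1 - inner ℂ w x‖ := by
  have h2 := norm_lt_one_of_mem hw
  have h3 := norm_sub_norm_le (1 : ℂ) (inner ℂ w x)
  rw [norm_one] at h3
  nlinarith [norm_inner_le_norm (𝕜 := ℂ) w x, norm_nonneg x]

lemma norm_kernel_le_two (hw : w ∈ unitBall n) (hx : x ∈ unitBall n) :
    ‖1 - inner ℂ w x‖ ≤ 2 := by
  have h1 := norm_inner_lt_one hw hx
  have h3 := norm_sub_le (1 : ℂ) (inner ℂ w x)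
  rw [norm_one] at h3
  linarith

lemma one_sub_norm_sq_le_kernel (hw : w ∈ unitBall n) (hx : x ∈ unitBall n) :
    1 - ‖w‖ ^ 2 ≤ 2 * ‖1 - inner ℂ w x‖ := by
  have h1 := norm_lt_one_of_mem hw
  have h2 := one_sub_norm_le_kernel_left w hx
  nlinarith [norm_nonneg w]

/-- Since ‖x‖, ‖w‖ < 1, expanding the square gives at most 2 Re(1 - ⟨x, w⟩). -/
lemma norm_sub_sq_le_kernel (hw : w ∈ unitBall n) (hx : x ∈ unitBall n) :
    ‖x - w‖ ^ 2 ≤ 2 * ‖1 - inner ℂ w x‖ := by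
  have h1 := norm_lt_one_of_mem hw
  have h2 := norm_lt_one_of_mem hx
  have h3 := Complex.re_le_norm (1 - inner ℂ w x)
  have h4 : ‖x - w‖ ^ 2 = ‖x‖ ^ 2 - 2 * (inner ℂ w x).re + ‖w‖ ^ 2 := by
    rw [norm_sub_sq (𝕜 := ℂ), ← inner_conj_symm]
    simp only [RCLike.conj_re]
    rfl
  simp only [Complex.sub_re, Complex.one_re] at h3
  rw [h4]
  nlinarith [norm_nonneg w, norm_nonneg x]

lemma kernel_self (w : Cn n) : 1 - inner ℂ w w = ((1 - ‖w‖ ^ 2 : ℝ) : ℂ) := by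
  rw [inner_self_eq_norm_sq_to_K]
  push_cast
  rfl

/-- The logarithmic derivative of the kernel is bounded in the Bergman metric. -/
lemma norm_inner_le_kernel (hw : w ∈ unitBall n) (hx : x ∈ unitBall n) (u : Cn n) :
    ‖inner ℂ w u‖ ≤ 3 * bergmanNorm x u * ‖1 - inner ℂ w x‖ := by
  by_cases hb : inner ℂ w u = 0
  · rw [hb, norm_zero]
    have := bergmanNorm_nonneg x u
    positivity
  have hu : u ≠ 0 := by
    rintro rfl
    simp at hb
  have hh := bergmanNorm_pos hx hu
  set b := inner ℂ w u with hbdef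
  have hb' : 0 < ‖b‖ := norm_pos_iff.mpr hb
  set r : ℝ := 1 / (3 * bergmanNorm x u) with hr
  have hr0 : 0 < r := by positivity
  -- The phase of c makes cb = r‖b‖ positive. As x + cu stays in the ball, the real part of the
  -- kernel is still positive there, which forces r‖b‖ < Re(1 - ⟨x, w⟩).
  set c : ℂ := r * (starRingEnd ℂ b / ‖b‖) with hc
  have hcn : ‖c‖ = r := by
    rw [hc, norm_mul, norm_div, RCLike.norm_conj, Complex.norm_real, Complex.norm_real, norm_norm,
      div_self hb'.ne', mul_one, Real.norm_of_nonneg hr0.le]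
  have hcb : c * b = ((r * ‖b‖ : ℝ) : ℂ) := by
    have h1 : starRingEnd ℂ b * b = (‖b‖ : ℂ) ^ 2 := Complex.conj_mul' b
    have h2 : (‖b‖ : ℂ) ≠ 0 := by exact_mod_cast hb'.ne'
    calc c * b = r * (starRingEnd ℂ b * b / ‖b‖) := by rw [hc]; ring
      _ = _ := by rw [h1]; push_cast; field_simp
  have hmem : x + c • u ∈ unitBall n := by
    refine add_smul_mem_unitBall hx ?_
    rw [hcn, hr]
    field_simp
    rfl
  have h1 := re_kernel_pos hw hmem
  rw [inner_add_right, inner_smul_right, ← hbdef, hcb, ← sub_sub, Complex.sub_re,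
    Complex.ofReal_re] at h1
  have h2 := Complex.re_le_norm (1 - inner ℂ w x)
  have h3 : r * ‖b‖ ≤ ‖1 - inner ℂ w x‖ := by linarith
  calc ‖b‖ = 3 * bergmanNorm x u * (r * ‖b‖) := by rw [hr]; field_simp
    _ ≤ _ := by gcongr

lemma hasFDerivAt_kernel (w x : Cn n) :
    HasFDerivAt (fun x => 1 - inner ℂ w x) (-(innerSL ℂ w)) x :=
  (innerSL ℂ w).hasFDerivAt.const_sub 1

end Kernel

/-! ### Bounded test functions -/

/-- The normalized kernel `(1 - ‖w‖²) / (1 - ⟨x, w⟩)`. -/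
noncomputable def normKernel (w x : Cn n) : ℂ := ((1 - ‖w‖ ^ 2 : ℝ) : ℂ) / (1 - inner ℂ w x)

/-- A bounded function vanishing at `w` with gradient `⟨·, w⟩ / (1 - ‖w‖²)` there. -/
noncomputable def testRadial (w x : Cn n) : ℂ := normKernel w x ^ 2 - normKernel w x

/-- A bounded function vanishing at `w` with gradient `⟨·, v⟩ / (1 - ‖w‖²)^{1/2}` there. -/
noncomputable def testTangential (w v x : Cn n) : ℂ :=
  (√(1 - ‖w‖ ^ 2) : ℂ) * inner ℂ v (x - w) / (1 - inner ℂ w x)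

section Bounded

variable {w x : Cn n}

lemma norm_normKernel (hw : w ∈ unitBall n) (x : Cn n) :
    ‖normKernel w x‖ = (1 - ‖w‖ ^ 2) / ‖1 - inner ℂ w x‖ := by
  rw [normKernel, norm_div, Complex.norm_real, Real.norm_of_nonneg (one_sub_norm_sq_pos hw).le]

lemma norm_normKernel_le_two (hw : w ∈ unitBall n) (hx : x ∈ unitBall n) :
    ‖normKernel w x‖ ≤ 2 := by
  rw [norm_normKernel hw]
  exact div_le_of_le_mul₀ (norm_nonneg _) zero_le_two (one_sub_norm_sq_le_kernel hw hx)

lemma normKernel_self (hw : w ∈ unitBall n) : normKernel w w = 1 := by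
  rw [normKernel, kernel_self]
  refine div_self ?_
  exact_mod_cast (one_sub_norm_sq_pos hw).ne'

lemma hasFDerivAt_normKernel (hw : w ∈ unitBall n) (hx : x ∈ unitBall n) :
    HasFDerivAt (normKernel w)
      ((((1 - ‖w‖ ^ 2 : ℝ) : ℂ) / (1 - inner ℂ w x) ^ 2) • innerSL ℂ w) x := by
  have h1 := (((hasDerivAt_inv (kernel_ne_zero hw hx)).comp_hasFDerivAt x
    (hasFDerivAt_kernel w x)).const_mul ((1 - ‖w‖ ^ 2 : ℝ) : ℂ))
  have h2 : normKernel w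
      = fun y => ((1 - ‖w‖ ^ 2 : ℝ) : ℂ) * (Inv.inv ∘ fun x => 1 - inner ℂ w x) y := by
    funext y
    simp [normKernel, div_eq_mul_inv]
  rw [h2]
  refine h1.congr_fderiv ?_
  ext u
  simp
  ring

lemma differentiableOn_testRadial (hw : w ∈ unitBall n) :
    DifferentiableOn ℂ (testRadial w) (unitBall n) := fun x hx => by
  have h := (hasFDerivAt_normKernel hw hx).differentiableAt
  exact ((h.pow 2).sub h).differentiableWithinAt

lemma testRadial_self (hw : w ∈ unitBall n) : testRadial w w = 0 := by
  simp [testRadial, normKernel_self hw]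

/-- With k the normalized kernel, (k² - k)' = (2k - 1)k', and k(w) = 1. -/
lemma fderiv_testRadial_self (hw : w ∈ unitBall n) (u : Cn n) :
    fderiv ℂ (testRadial w) w u = inner ℂ w u / ((1 - ‖w‖ ^ 2 : ℝ) : ℂ) := by
  have hA : ((1 - ‖w‖ ^ 2 : ℝ) : ℂ) ≠ 0 := by exact_mod_cast (one_sub_norm_sq_pos hw).ne'
  have h := hasFDerivAt_normKernel hw hw
  have h2 : HasFDerivAt (testRadial w) _ w := (h.pow 2).sub h
  rw [h2.fderiv, kernel_self]
  simp only [normKernel_self hw, sub_apply, smul_apply,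
    innerSL_apply_apply]
  simp only [smul_eq_mul, one_pow]
  field_simp
  simp
  ring

/-- From |k| ≤ 2 one gets |k|² + |k| ≤ 3|k|, and |k| decays at fixed x as ‖w‖ → 1. -/
lemma norm_testRadial_le (hw : w ∈ unitBall n) (hx : x ∈ unitBall n) :
    ‖testRadial w x‖ ≤ 3 * ((1 - ‖w‖ ^ 2) / (1 - ‖x‖)) := by
  have hx1 := norm_lt_one_of_mem hx
  have hA := one_sub_norm_sq_pos hw
  have h1 := norm_normKernel_le_two hw hx
  have h2 : ‖normKernel w x‖ ≤ (1 - ‖w‖ ^ 2) / (1 - ‖x‖) := by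
    rw [norm_normKernel hw]
    gcongr
    exact one_sub_norm_le_kernel_right hw x
  have h3 : ‖testRadial w x‖ ≤ ‖normKernel w x‖ ^ 2 + ‖normKernel w x‖ := by
    rw [← norm_pow]
    exact norm_sub_le _ _
  nlinarith [norm_nonneg (normKernel w x)]

lemma norm_testRadial_le_six (hw : w ∈ unitBall n) (hx : x ∈ unitBall n) :
    ‖testRadial w x‖ ≤ 6 := by
  have h1 := norm_normKernel_le_two hw hx
  have h3 : ‖testRadial w x‖ ≤ ‖normKernel w x‖ ^ 2 + ‖normKernel w x‖ := by
    rw [← norm_pow]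
    exact norm_sub_le _ _
  nlinarith [norm_nonneg (normKernel w x)]

variable {v : Cn n}

lemma hasFDerivAt_testTangential_numerator (w v x : Cn n) :
    HasFDerivAt (fun x => (√(1 - ‖w‖ ^ 2) : ℂ) * inner ℂ v (x - w))
      ((√(1 - ‖w‖ ^ 2) : ℂ) • innerSL ℂ v) x := by
  have h := ((innerSL ℂ v).hasFDerivAt (x := x - w)).comp x ((hasFDerivAt_id x).sub_const w)
  exact h.const_mul _

lemma hasFDerivAt_testTangential (hw : w ∈ unitBall n) (hx : x ∈ unitBall n) :
    HasFDerivAt (testTangential w v)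
      (((√(1 - ‖w‖ ^ 2) : ℂ) * inner ℂ v (x - w) / (1 - inner ℂ w x) ^ 2) • innerSL ℂ w
        + ((√(1 - ‖w‖ ^ 2) : ℂ) / (1 - inner ℂ w x)) • innerSL ℂ v) x := by
  have h1 := (hasFDerivAt_testTangential_numerator w v x).mul
    ((hasDerivAt_inv (kernel_ne_zero hw hx)).comp_hasFDerivAt x (hasFDerivAt_kernel w x))
  refine (h1.congr_of_eventuallyEq (.of_forall fun y => by
    simp [testTangential, div_eq_mul_inv])).congr_fderiv ?_
  ext u
  simp
  ring

lemma differentiableOn_testTangential (hw : w ∈ unitBall n) :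
    DifferentiableOn ℂ (testTangential w v) (unitBall n) := fun _ hx =>
  (hasFDerivAt_testTangential hw hx).differentiableAt.differentiableWithinAt

lemma testTangential_self (w v : Cn n) : testTangential w v w = 0 := by
  simp [testTangential]

/-- The derivative of the denominator is multiplied by ⟨x - w, v⟩, which vanishes at x = w. -/
lemma fderiv_testTangential_self (hw : w ∈ unitBall n) (u : Cn n) :
    fderiv ℂ (testTangential w v) w u = inner ℂ v u / (√(1 - ‖w‖ ^ 2) : ℂ) := by
  have hA := one_sub_norm_sq_pos hw
  have hs : (√(1 - ‖w‖ ^ 2) : ℂ) ≠ 0 := by exact_mod_cast (Real.sqrt_pos.mpr hA).ne'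
  have hs2 : ((1 - ‖w‖ ^ 2 : ℝ) : ℂ) = (√(1 - ‖w‖ ^ 2) : ℂ) ^ 2 := by
    exact_mod_cast (Real.sq_sqrt hA.le).symm
  rw [(hasFDerivAt_testTangential hw hw).fderiv, kernel_self, hs2]
  simp
  field_simp

lemma norm_inner_sub_mul_sqrt_le (w x : Cn n) (hv : ‖v‖ ≤ 1) :
    ‖(√(1 - ‖w‖ ^ 2) : ℂ) * inner ℂ v (x - w)‖ ≤ √(1 - ‖w‖ ^ 2) * ‖x - w‖ := by
  rw [norm_mul, Complex.norm_real, Real.norm_of_nonneg (Real.sqrt_nonneg _)]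
  gcongr
  calc _ ≤ ‖v‖ * ‖x - w‖ := norm_inner_le_norm _ _
    _ ≤ 1 * ‖x - w‖ := by gcongr
    _ = _ := one_mul _

lemma norm_testTangential_le (hw : w ∈ unitBall n) (hx : x ∈ unitBall n) (hv : ‖v‖ ≤ 1) :
    ‖testTangential w v x‖ ≤ √(1 - ‖w‖ ^ 2) * (2 / (1 - ‖x‖)) := by
  have hx1 := norm_lt_one_of_mem hx
  rw [testTangential, norm_div]
  calc _ ≤ √(1 - ‖w‖ ^ 2) * 2 / (1 - ‖x‖) := by
        have h1 : 0 < 1 - ‖x‖ := by linarith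
        gcongr
        · refine (norm_inner_sub_mul_sqrt_le w x hv).trans ?_
          gcongr
          linarith [norm_sub_le x w, norm_lt_one_of_mem hw]
        · exact one_sub_norm_le_kernel_right hw x
    _ = _ := by ring

/-- Both 1 - ‖w‖² and ‖x - w‖² are at most twice the modulus of the kernel, so their product is at
most four times its square. -/
lemma norm_testTangential_le_two (hw : w ∈ unitBall n) (hx : x ∈ unitBall n) (hv : ‖v‖ ≤ 1) :
    ‖testTangential w v x‖ ≤ 2 := by
  rw [testTangential, norm_div]
  refine div_le_of_le_mul₀ (norm_nonneg _) zero_le_two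
    ((norm_inner_sub_mul_sqrt_le w x hv).trans ?_)
  have hA := one_sub_norm_sq_pos hw
  refine abs_le_of_sq_le_sq' ?_ (by positivity) |>.2
  rw [mul_pow, Real.sq_sqrt hA.le]
  have h1 := one_sub_norm_sq_le_kernel hw hx
  have h2 := norm_sub_sq_le_kernel hw hx
  calc _ ≤ (2 * ‖1 - inner ℂ w x‖) * (2 * ‖1 - inner ℂ w x‖) := by gcongr
    _ = _ := by ring

end Bounded

/-! ### Logarithmic test functions -/

/-- The quantity `log (1 / (1 - ‖w‖²))`. -/
noncomputable def logWeight (w : Cn n) : ℝ := -Real.log (1 - ‖w‖ ^ 2)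

/-- A Bloch function whose value at `w` is of the maximal logarithmic size and which is small away
from `w` when `w` is close to the sphere. -/
noncomputable def testLog (w x : Cn n) : ℂ :=
  Complex.log (1 - inner ℂ w x) ^ 2 / ((1 + logWeight w : ℝ) : ℂ)

section Log

variable {w x : Cn n}

lemma logWeight_nonneg (hw : w ∈ unitBall n) : 0 ≤ logWeight w :=
  neg_nonneg.mpr (Real.log_nonpos (one_sub_norm_sq_pos hw).le (by nlinarith [sq_nonneg ‖w‖]))

lemma log_two_le_one : Real.log 2 ≤ 1 := by
  linarith [Real.log_two_lt_d9]

/-- The modulus of the kernel lies in [m, 2], so the real part of the logarithm is at most 1 - log m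
in size; the argument adds at most π ≤ 4. Taking m = 1 - ‖w‖ serves the gradient bound, m = 1 - ‖x‖
the decay at fixed x. -/
lemma norm_log_kernel_le (hw : w ∈ unitBall n) (hx : x ∈ unitBall n) {m : ℝ} (hm0 : 0 < m)
    (hm1 : m ≤ 1) (hm : m ≤ ‖1 - inner ℂ w x‖) :
    ‖Complex.log (1 - inner ℂ w x)‖ ≤ 5 - Real.log m := by
  have h1 := Complex.norm_le_abs_re_add_abs_im (Complex.log (1 - inner ℂ w x))
  have h2 := Complex.abs_arg_le_pi (1 - inner ℂ w x)
  rw [Complex.log_re, Complex.log_im] at h1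
  have h3 : |Real.log ‖1 - inner ℂ w x‖| ≤ 1 - Real.log m := by
    have hm' := Real.log_nonpos hm0.le hm1
    have h4 := Real.log_le_log hm0 hm
    have h5 := Real.log_le_log (hm0.trans_le hm) (norm_kernel_le_two hw hx)
    rw [abs_le]
    constructor <;> linarith [log_two_le_one]
  linarith [Real.pi_le_four]

lemma log_one_div_le (hw : w ∈ unitBall n) : -Real.log (1 - ‖w‖) ≤ 1 + logWeight w := by
  have h1 := norm_lt_one_of_mem hw
  have h2 : Real.log (1 - ‖w‖ ^ 2) ≤ Real.log (2 * (1 - ‖w‖)) :=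
    Real.log_le_log (one_sub_norm_sq_pos hw) (by nlinarith [norm_nonneg w])
  rw [Real.log_mul two_ne_zero (by linarith)] at h2
  rw [logWeight]
  linarith [log_two_le_one]

lemma hasFDerivAt_testLog (hw : w ∈ unitBall n) (hx : x ∈ unitBall n) :
    HasFDerivAt (testLog w)
      ((-(2 * Complex.log (1 - inner ℂ w x)) / ((1 + logWeight w : ℝ) : ℂ)
        / (1 - inner ℂ w x)) • innerSL ℂ w) x := by
  have hs : 1 - inner ℂ w x ∈ Complex.slitPlane := Or.inl (re_kernel_pos hw hx)
  have h1 := ((((Complex.hasDerivAt_log hs).pow 2).comp_hasFDerivAt x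
    (hasFDerivAt_kernel w x)).mul_const (((1 + logWeight w : ℝ) : ℂ)⁻¹))
  have h2 : testLog w = fun y => ((Complex.log ^ 2) ∘ fun x => 1 - inner ℂ w x) y
      * ((1 + logWeight w : ℝ) : ℂ)⁻¹ := by
    funext y
    simp [testLog, div_eq_mul_inv]
  rw [h2]
  refine h1.congr_fderiv ?_
  ext u
  simp
  ring

lemma differentiableOn_testLog (hw : w ∈ unitBall n) :
    DifferentiableOn ℂ (testLog w) (unitBall n) := fun _ hx =>
  (hasFDerivAt_testLog hw hx).differentiableAt.differentiableWithinAt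

/-- With q the kernel and L the weight, |log q| ≤ 6 + L ≤ 6(1 + L), so 2|log q|/(1 + L) ≤ 12. The
remaining factor ⟨u, w⟩/q costs 3 Bergman lengths. -/
lemma norm_fderiv_testLog_le (hw : w ∈ unitBall n) (hx : x ∈ unitBall n) (u : Cn n) :
    ‖fderiv ℂ (testLog w) x u‖ ≤ 36 * bergmanNorm x u := by
  have hL := logWeight_nonneg hw
  have hw1 := norm_lt_one_of_mem hw
  have hq : 0 < ‖1 - inner ℂ w x‖ := norm_pos_iff.mpr (kernel_ne_zero hw hx)
  have h1 := norm_log_kernel_le hw hx (by linarith) (by linarith [norm_nonneg w])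
    (one_sub_norm_le_kernel_left w hx)
  have h2 := log_one_div_le hw
  have h3 := norm_inner_le_kernel hw hx u
  rw [(hasFDerivAt_testLog hw hx).fderiv, smul_apply, innerSL_apply_apply,
    norm_smul, norm_div, norm_div, norm_neg, norm_mul, Complex.norm_real,
    Real.norm_of_nonneg (by linarith), Complex.norm_ofNat]
  have h4 : 2 * ‖Complex.log (1 - inner ℂ w x)‖ / (1 + logWeight w) ≤ 12 := by
    rw [div_le_iff₀ (by linarith)]
    linarith
  calc _ ≤ 12 / ‖1 - inner ℂ w x‖ * (3 * bergmanNorm x u * ‖1 - inner ℂ w x‖) := by gcongr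
    _ = _ := by field_simp; ring

lemma testLog_zero (w : Cn n) : testLog w 0 = 0 := by
  simp [testLog]

lemma norm_testLog_self (hw : w ∈ unitBall n) :
    ‖testLog w w‖ = logWeight w ^ 2 / (1 + logWeight w) := by
  have hL := logWeight_nonneg hw
  rw [testLog, kernel_self, ← Complex.ofReal_log (one_sub_norm_sq_pos hw).le, norm_div, norm_pow,
    Complex.norm_real, Complex.norm_real, Real.norm_of_nonneg (by linarith : 0 ≤ 1 + logWeight w),
    Real.norm_eq_abs, sq_abs, logWeight]
  ring

lemma norm_testLog_le (hw : w ∈ unitBall n) (hx : x ∈ unitBall n) :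
    ‖testLog w x‖ ≤ (5 - Real.log (1 - ‖x‖)) ^ 2 / (1 + logWeight w) := by
  have hL := logWeight_nonneg hw
  have hx1 := norm_lt_one_of_mem hx
  rw [testLog, norm_div, norm_pow, Complex.norm_real,
    Real.norm_of_nonneg (by linarith : 0 ≤ 1 + logWeight w)]
  gcongr
  exact norm_log_kernel_le hw hx (by linarith) (by linarith [norm_nonneg x])
    (one_sub_norm_le_kernel_right hw x)

/-- The hyperbolic size of `w` in terms of the value of the logarithmic test function. -/
lemma log_div_le_logWeight (hw : w ∈ unitBall n) :
    Real.log ((1 + ‖w‖) / (1 - ‖w‖)) ≤ 2 + logWeight w := by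
  have h1 := norm_lt_one_of_mem hw
  have h0 := norm_nonneg w
  have h2 := log_one_div_le hw
  have h3 := Real.log_le_log (by linarith) (by linarith : 1 + ‖w‖ ≤ 2)
  rw [Real.log_div (by linarith) (by linarith)]
  linarith [log_two_le_one]

end Log

/-! ### Test functions as elements of the Bloch space -/

/-- The direction of `v` (and `0` if `v = 0`). -/
noncomputable def direction (v : Cn n) : Cn n := (‖v‖⁻¹ : ℂ) • v

lemma norm_direction_le (v : Cn n) : ‖direction v‖ ≤ 1 := by
  rw [direction, norm_smul, norm_inv, Complex.norm_real, norm_norm]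
  exact inv_mul_le_one

lemma inner_direction (v : Cn n) : inner ℂ (direction v) v = (‖v‖ : ℂ) := by
  rw [direction, inner_smul_left, inner_self_eq_norm_sq_to_K]
  by_cases hv : v = 0
  · simp [hv]
  have : (‖v‖ : ℂ) ≠ 0 := by exact_mod_cast (norm_pos_iff.mpr hv).ne'
  simp
  field_simp

/-- The radial test sees the inner product term of the Bergman length, and the tangential test in
the direction of v sees the term in ‖v‖. -/
lemma bergmanNorm_le_tests {w : Cn n} (hw : w ∈ unitBall n) (v : Cn n) :
    bergmanNorm w v ≤ ‖fderiv ℂ (testRadial w) w v‖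
      + ‖fderiv ℂ (testTangential w (direction v)) w v‖ := by
  have hA := one_sub_norm_sq_pos hw
  refine (bergmanNorm_le_add hw v).trans (le_of_eq ?_)
  rw [fderiv_testRadial_self hw, fderiv_testTangential_self hw, inner_direction, norm_div,
    norm_div, Complex.norm_real, Complex.norm_real, Complex.norm_real, norm_norm,
    Real.norm_of_nonneg hA.le, Real.norm_of_nonneg (Real.sqrt_nonneg _), add_comm]

section Tests

variable {w : Cn n}

lemma norm_fderiv_testRadial_le (hw : w ∈ unitBall n) {x : Cn n} (hx : x ∈ unitBall n)
    (u : Cn n) : ‖fderiv ℂ (testRadial w) x u‖ ≤ 18 * bergmanNorm x u := by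
  refine (norm_fderiv_le_of_bounded (differentiableOn_testRadial hw)
    (fun x hx => norm_testRadial_le_six hw hx) hx u).trans (le_of_eq ?_)
  norm_num

lemma norm_fderiv_testTangential_le (hw : w ∈ unitBall n) {v : Cn n} (hv : ‖v‖ ≤ 1) {x : Cn n}
    (hx : x ∈ unitBall n) (u : Cn n) :
    ‖fderiv ℂ (testTangential w v) x u‖ ≤ 6 * bergmanNorm x u := by
  refine (norm_fderiv_le_of_bounded (differentiableOn_testTangential hw)
    (fun x hx => norm_testTangential_le_two hw hx hv) hx u).trans (le_of_eq ?_)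
  norm_num

lemma isBloch_testRadial (hw : w ∈ unitBall n) : IsBloch (testRadial w) :=
  isBloch_of_le (differentiableOn_testRadial hw) (by norm_num)
    fun _ hx u => norm_fderiv_testRadial_le hw hx u

lemma isBloch_testTangential (hw : w ∈ unitBall n) {v : Cn n} (hv : ‖v‖ ≤ 1) :
    IsBloch (testTangential w v) :=
  isBloch_of_le (differentiableOn_testTangential hw) (by norm_num)
    fun _ hx u => norm_fderiv_testTangential_le hw hv hx u

lemma isBloch_testLog (hw : w ∈ unitBall n) : IsBloch (testLog w) :=
  isBloch_of_le (differentiableOn_testLog hw) (by norm_num)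
    fun _ hx u => norm_fderiv_testLog_le hw hx u

/-- The three families have norms at most 6 + 18, 2 + 6 and 36; 40 is a common bound. -/
lemma norm_mk_testRadial_le (hw : w ∈ unitBall n) : ‖BlochSpace.mk (testRadial w)‖ ≤ 40 := by
  refine (BlochSpace.norm_mk_le (differentiableOn_testRadial hw)
    (norm_testRadial_le_six hw (by simp)) (by norm_num)
    fun _ hx u => norm_fderiv_testRadial_le hw hx u).trans (by norm_num)

lemma norm_mk_testTangential_le (hw : w ∈ unitBall n) {v : Cn n} (hv : ‖v‖ ≤ 1) :
    ‖BlochSpace.mk (testTangential w v)‖ ≤ 40 := by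
  refine (BlochSpace.norm_mk_le (differentiableOn_testTangential hw)
    (norm_testTangential_le_two hw (by simp) hv) (by norm_num)
    fun _ hx u => norm_fderiv_testTangential_le hw hv hx u).trans (by norm_num)

lemma norm_mk_testLog_le (hw : w ∈ unitBall n) : ‖BlochSpace.mk (testLog w)‖ ≤ 40 := by
  refine (BlochSpace.norm_mk_le (differentiableOn_testLog hw) (a := 0)
    (by rw [testLog_zero, norm_zero]) (by norm_num)
    fun _ hx u => norm_fderiv_testLog_le hw hx u).trans (by norm_num)

end Tests

/-! ### The quantity `T_φ` -/

section BigT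

variable {φ : Cn n → Cn n} {z : Cn n}

lemma fderiv_comp_apply {f : Cn n → ℂ} (hf : DifferentiableOn ℂ f (unitBall n))
    (hd : DifferentiableAt ℂ φ z) (hw : φ z ∈ unitBall n) (u : Cn n) :
    fderiv ℂ (f ∘ φ) z u = fderiv ℂ f (φ z) (fderiv ℂ φ z u) := by
  rw [fderiv_comp z (differentiableAt_of_mem hf hw) hd]
  rfl

/-- By the chain rule, T_φ(z) is bounded by the distortion of Bergman lengths under φ'(z). The
factor a, later ψ(z), is included so that its vanishing needs no separate treatment. -/
lemma enorm_mul_bigT_le (hz : z ∈ unitBall n) (hd : DifferentiableAt ℂ φ z)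
    (hw : φ z ∈ unitBall n) {a : ℂ} {c : ℝ} (hc : 0 ≤ c)
    (h : ∀ u, ‖a‖ * bergmanNorm (φ z) (fderiv ℂ φ z u) ≤ c * bergmanNorm z u) :
    ‖a‖ₑ * bigT φ z ≤ ENNReal.ofReal c := by
  by_cases ha : a = 0
  · simp [ha]
  have ha' : 0 < ‖a‖ := norm_pos_iff.mpr ha
  have h1 : bigT φ z ≤ ENNReal.ofReal (c / ‖a‖) := by
    refine iSup₂_le fun f hf => (blochQ_le_iff hz (by positivity)).mpr fun u => ?_
    have h2 := (blochBeta_le_iff zero_le_one).mp (hf.2.trans (by simp)) _ hw (fderiv ℂ φ z u)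
    rw [fderiv_comp_apply hf.1.1 hd hw]
    rw [one_mul] at h2
    refine h2.trans ?_
    rw [div_mul_eq_mul_div, le_div_iff₀ ha', mul_comm]
    exact h u
  calc _ ≤ ‖a‖ₑ * ENNReal.ofReal (c / ‖a‖) := by gcongr
    _ = _ := by
      rw [← ofReal_norm, ← ENNReal.ofReal_mul ha'.le]
      congr 1
      field_simp

/-- Only finiteness matters: it permits the passage to `toReal`. -/
lemma bigT_lt_top (hz : z ∈ unitBall n) (hd : DifferentiableAt ℂ φ z)
    (hw : φ z ∈ unitBall n) : bigT φ z < ∞ := by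
  have hA := one_sub_norm_sq_pos hw
  have h := enorm_mul_bigT_le hz hd hw (a := 1) (c := ‖fderiv ℂ φ z‖ / (1 - ‖φ z‖ ^ 2))
    (by positivity) fun u => by
      rw [norm_one, one_mul]
      calc _ ≤ ‖fderiv ℂ φ z u‖ / (1 - ‖φ z‖ ^ 2) := bergmanNorm_le hw _
        _ ≤ ‖fderiv ℂ φ z‖ * ‖u‖ / (1 - ‖φ z‖ ^ 2) := by
          gcongr
          exact ContinuousLinearMap.le_opNorm _ _
        _ ≤ ‖fderiv ℂ φ z‖ * bergmanNorm z u / (1 - ‖φ z‖ ^ 2) := by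
          gcongr
          exact norm_le_bergmanNorm hz u
        _ = _ := by ring
  rw [enorm_one, one_mul] at h
  exact h.trans_lt ENNReal.ofReal_lt_top

/-- The homogeneous form of the definition of T_φ, applied to f/c; for c = 0 the derivative at φ(z)
vanishes. -/
lemma norm_fderiv_comp_le_bigT (hz : z ∈ unitBall n) (hd : DifferentiableAt ℂ φ z)
    (hw : φ z ∈ unitBall n) {f : Cn n → ℂ} (hf : DifferentiableOn ℂ f (unitBall n)) {c : ℝ}
    (hc : 0 ≤ c) (h : ∀ x ∈ unitBall n, ∀ u, ‖fderiv ℂ f x u‖ ≤ c * bergmanNorm x u) (u : Cn n) :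
    ‖fderiv ℂ f (φ z) (fderiv ℂ φ z u)‖ ≤ c * (bigT φ z).toReal * bergmanNorm z u := by
  obtain rfl | hc := hc.eq_or_lt
  · simpa using h _ hw (fderiv ℂ φ z u)
  have hg : ∀ x ∈ unitBall n, fderiv ℂ ((c⁻¹ : ℂ) • f) x = (c⁻¹ : ℂ) • fderiv ℂ f x :=
    fun x hx => fderiv_const_smul (differentiableAt_of_mem hf hx) _
  have hn : ‖(c⁻¹ : ℂ)‖ = c⁻¹ := by
    rw [norm_inv, Complex.norm_real, Real.norm_of_nonneg hc.le]
  have hgb : ∀ x ∈ unitBall n, ∀ u, ‖fderiv ℂ ((c⁻¹ : ℂ) • f) x u‖ ≤ 1 * bergmanNorm x u :=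
    fun x hx u => by
      rw [hg x hx, smul_apply, norm_smul, hn, inv_mul_le_iff₀ hc, one_mul]
      exact h x hx u
  have hgB := isBloch_of_le (hf.const_smul (c⁻¹ : ℂ)) zero_le_one hgb
  have h1 : blochQ (((c⁻¹ : ℂ) • f) ∘ φ) z ≤ bigT φ z :=
    le_iSup₂ (f := fun (f : Cn n → ℂ) (_ : IsBloch f ∧ blochBeta f ≤ 1) => blochQ (f ∘ φ) z)
      ((c⁻¹ : ℂ) • f) ⟨hgB, ((blochBeta_le_iff zero_le_one).mpr hgb).trans (by simp)⟩
  rw [← ENNReal.ofReal_toReal (bigT_lt_top hz hd hw).ne] at h1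
  have h2 := (blochQ_le_iff hz ENNReal.toReal_nonneg).mp h1 u
  rw [fderiv_comp_apply hgB.1 hd hw, hg _ hw, smul_apply, norm_smul, hn,
    inv_mul_le_iff₀ hc] at h2
  linarith

/-- A converse to the chain rule bound: T_φ controls φ' itself. The constant is 18 + 6, from the two
bounded tests at φ(z). -/
lemma bergmanNorm_le_bigT (hz : z ∈ unitBall n) (hd : DifferentiableAt ℂ φ z)
    (hw : φ z ∈ unitBall n) (u : Cn n) :
    bergmanNorm (φ z) (fderiv ℂ φ z u) ≤ 24 * (bigT φ z).toReal * bergmanNorm z u := by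
  have hv := norm_direction_le (fderiv ℂ φ z u)
  have h1 := norm_fderiv_comp_le_bigT hz hd hw (differentiableOn_testRadial hw) (c := 18)
    (by norm_num) (fun x hx u => norm_fderiv_testRadial_le hw hx u) u
  have h2 := norm_fderiv_comp_le_bigT hz hd hw (differentiableOn_testTangential hw) (c := 6)
    (by norm_num) (fun x hx u => norm_fderiv_testTangential_le hw hv hx u) u
  linarith [bergmanNorm_le_tests hw (fderiv ℂ φ z u)]

end BigT

/-! ### The quantity `ω` -/

section Omega

variable {w : Cn n}

lemma omega_le_log (hw : w ∈ unitBall n) :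
    omega w ≤ ENNReal.ofReal (1 / 2 * Real.log ((1 + ‖w‖) / (1 - ‖w‖))) := by
  refine iSup₂_le fun f ⟨hf, h0, h1⟩ => ?_
  have h2 : blochBeta f ≤ ENNReal.ofReal 1 := by
    refine (le_add_self.trans h1).trans (by simp)
  have h3 := norm_sub_zero_le_log hf.1 zero_le_one ((blochBeta_le_iff zero_le_one).mp h2) hw
  rw [h0, sub_zero, one_mul] at h3
  rw [← ofReal_norm]
  exact ENNReal.ofReal_le_ofReal h3

lemma omega_lt_top (hw : w ∈ unitBall n) : omega w < ∞ :=
  (omega_le_log hw).trans_lt ENNReal.ofReal_lt_top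

/-- The homogeneous form of the definition of ω, applied to (f - f(0))/c. -/
lemma norm_sub_zero_le_omega (hw : w ∈ unitBall n) {f : Cn n → ℂ}
    (hf : DifferentiableOn ℂ f (unitBall n)) {c : ℝ} (hc : 0 ≤ c)
    (h : ∀ x ∈ unitBall n, ∀ u, ‖fderiv ℂ f x u‖ ≤ c * bergmanNorm x u) :
    ‖f w - f 0‖ ≤ c * (omega w).toReal := by
  obtain rfl | hc := hc.eq_or_lt
  · simpa using norm_sub_zero_le_log hf le_rfl h hw
  set g : Cn n → ℂ := (c⁻¹ : ℂ) • fun x => f x - f 0 with hgdef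
  have hfd : DifferentiableOn ℂ (fun x => f x - f 0) (unitBall n) := hf.sub_const _
  have hn : ‖(c⁻¹ : ℂ)‖ = c⁻¹ := by
    rw [norm_inv, Complex.norm_real, Real.norm_of_nonneg hc.le]
  have hgb : ∀ x ∈ unitBall n, ∀ u, ‖fderiv ℂ g x u‖ ≤ 1 * bergmanNorm x u := fun x hx u => by
    rw [hgdef, fderiv_const_smul (differentiableAt_of_mem hfd hx), fderiv_sub_const, smul_apply,
      norm_smul, hn, inv_mul_le_iff₀ hc, one_mul]
    exact h x hx u
  have hg0 : g 0 = 0 := by simp [hgdef]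
  have hgB := isBloch_of_le (hfd.const_smul (c⁻¹ : ℂ)) zero_le_one hgb
  have hgN : blochNorm g ≤ 1 := by
    rw [blochNorm, hg0, enorm_zero, zero_add]
    exact ((blochBeta_le_iff zero_le_one).mpr hgb).trans (by simp)
  have h1 : ‖g w‖ₑ ≤ omega w :=
    le_iSup₂ (f := fun (f : Cn n → ℂ) (_ : IsBloch f ∧ f 0 = 0 ∧ blochNorm f ≤ 1) => ‖f w‖ₑ)
      g ⟨hgB, hg0, hgN⟩
  have h2 := ENNReal.toReal_mono (omega_lt_top hw).ne h1
  rw [toReal_enorm, hgdef, Pi.smul_apply, norm_smul, hn, inv_mul_le_iff₀ hc] at h2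
  exact h2

end Omega

lemma blochQ_mul_ofReal_le {ψ : Cn n → ℂ} {z : Cn n} (hz : z ∈ unitBall n) {a c : ℝ}
    (ha : 0 ≤ a) (hc : 0 ≤ c) (h : ∀ u, ‖fderiv ℂ ψ z u‖ * a ≤ c * bergmanNorm z u) :
    blochQ ψ z * ENNReal.ofReal a ≤ ENNReal.ofReal c := by
  obtain rfl | ha := ha.eq_or_lt
  · simp
  have h1 : blochQ ψ z ≤ ENNReal.ofReal (c / a) := by
    refine (blochQ_le_iff hz (by positivity)).mpr fun u => ?_
    rw [div_mul_eq_mul_div, le_div_iff₀ ha]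
    exact h u
  calc _ ≤ ENNReal.ofReal (c / a) * ENNReal.ofReal a := by gcongr
    _ = _ := by
      rw [← ENNReal.ofReal_mul (by positivity)]
      congr 1
      field_simp

lemma IsBloch.blochQ_lt_top {ψ : Cn n → ℂ} (hψ : IsBloch ψ) {z : Cn n} (hz : z ∈ unitBall n) :
    blochQ ψ z < ∞ :=
  (le_iSup₂ (f := fun (z : Cn n) (_ : z ∈ unitBall n) => blochQ ψ z) z hz).trans_lt hψ.2

lemma IsBloch.norm_fderiv_le_blochQ {ψ : Cn n → ℂ} (hψ : IsBloch ψ) {z : Cn n}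
    (hz : z ∈ unitBall n) (u : Cn n) :
    ‖fderiv ℂ ψ z u‖ ≤ (blochQ ψ z).toReal * bergmanNorm z u :=
  (blochQ_le_iff hz ENNReal.toReal_nonneg).mp
    (ENNReal.ofReal_toReal (hψ.blochQ_lt_top hz).ne).ge u

/-! ### Derivatives of weighted compositions -/

section WeightedComp

variable {ψ : Cn n → ℂ} {φ : Cn n → Cn n}

lemma fderiv_weightedComp (hψ : DifferentiableOn ℂ ψ (unitBall n))
    (hφ : DifferentiableOn ℂ φ (unitBall n)) (hmaps : Set.MapsTo φ (unitBall n) (unitBall n))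
    {f : Cn n → ℂ} (hf : DifferentiableOn ℂ f (unitBall n)) {z : Cn n} (hz : z ∈ unitBall n)
    (u : Cn n) :
    fderiv ℂ (fun z => ψ z * f (φ z)) z u
      = ψ z * fderiv ℂ f (φ z) (fderiv ℂ φ z u) + f (φ z) * fderiv ℂ ψ z u := by
  have hφz : DifferentiableAt ℂ φ z := hφ.differentiableAt (Metric.isOpen_ball.mem_nhds hz)
  have h1 := ((differentiableAt_of_mem hψ hz).hasFDerivAt.mul
    ((differentiableAt_of_mem hf (hmaps hz)).hasFDerivAt.comp z hφz.hasFDerivAt))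
  have h2 : HasFDerivAt (fun z => ψ z * f (φ z)) _ z := h1
  rw [h2.fderiv]
  simp

lemma IsWeightedComp.fderiv_apply {T : BlochSpace n →L[ℂ] BlochSpace n}
    (hT : IsWeightedComp ψ φ T) (hψ : DifferentiableOn ℂ ψ (unitBall n))
    (hφ : DifferentiableOn ℂ φ (unitBall n)) (hmaps : Set.MapsTo φ (unitBall n) (unitBall n))
    (f : BlochSpace n) {z : Cn n} (hz : z ∈ unitBall n) (u : Cn n) :
    fderiv ℂ (T f) z u
      = ψ z * fderiv ℂ f (φ z) (fderiv ℂ φ z u) + f (φ z) * fderiv ℂ ψ z u := by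
  rw [BlochSpace.fderiv_eq_of_eqOn (hT f) hz,
    fderiv_weightedComp hψ hφ hmaps f.differentiableOn hz]

/-- The boundedness of `T` on test functions vanishing at `φ(z)` bounds `|ψ(z)| T_φ(z)`. -/
lemma IsWeightedComp.enorm_mul_bigT_le {T : BlochSpace n →L[ℂ] BlochSpace n}
    (hT : IsWeightedComp ψ φ T) (hψ : DifferentiableOn ℂ ψ (unitBall n))
    (hφ : DifferentiableOn ℂ φ (unitBall n)) (hmaps : Set.MapsTo φ (unitBall n) (unitBall n))
    {z : Cn n} (hz : z ∈ unitBall n) {R : ℝ}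
    (h1 : ‖T (BlochSpace.mk (testRadial (φ z)))‖ ≤ R)
    (h2 : ∀ v : Cn n, ‖v‖ ≤ 1 → ‖T (BlochSpace.mk (testTangential (φ z) v))‖ ≤ R) :
    ‖ψ z‖ₑ * bigT φ z ≤ ENNReal.ofReal (2 * R) := by
  have hR : 0 ≤ R := (norm_nonneg _).trans h1
  have hw := hmaps hz
  -- Vanishing at φ(z) removes the term with ψ' from the product rule.
  have key : ∀ f : Cn n → ℂ, IsBloch f → f (φ z) = 0 → ‖T (BlochSpace.mk f)‖ ≤ R →
      ∀ u, ‖ψ z‖ * ‖fderiv ℂ f (φ z) (fderiv ℂ φ z u)‖ ≤ R * bergmanNorm z u := by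
    intro f hf h0 hfR u
    have h3 := hT.fderiv_apply hψ hφ hmaps (BlochSpace.mk f) hz u
    rw [BlochSpace.mk_apply hf hw, h0, zero_mul, add_zero,
      BlochSpace.fderiv_eq_of_eqOn (fun x hx => BlochSpace.mk_apply hf hx) hw] at h3
    rw [← norm_mul, ← h3]
    refine (BlochSpace.norm_fderiv_le _ hz u).trans ?_
    gcongr
    exact bergmanNorm_nonneg z u
  refine BlochBall.enorm_mul_bigT_le hz (hφ.differentiableAt (Metric.isOpen_ball.mem_nhds hz)) hw
    (by positivity) fun u => ?_
  set v := fderiv ℂ φ z u with hv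
  have h3 := key _ (isBloch_testRadial hw) (testRadial_self hw) h1 u
  have h4 := key _ (isBloch_testTangential hw (norm_direction_le v)) (testTangential_self _ _)
    (h2 _ (norm_direction_le v)) u
  calc _ ≤ ‖ψ z‖ * (‖fderiv ℂ (testRadial (φ z)) (φ z) v‖
        + ‖fderiv ℂ (testTangential (φ z) (direction v)) (φ z) v‖) := by
        gcongr
        exact bergmanNorm_le_tests hw v
    _ ≤ _ := by rw [← hv] at h3 h4; linarith

/-- The boundedness of `T` on logarithmic test functions bounds `Q_ψ(z)`. -/
lemma IsWeightedComp.blochQ_mul_le {T : BlochSpace n →L[ℂ] BlochSpace n}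
    (hT : IsWeightedComp ψ φ T) (hψ : DifferentiableOn ℂ ψ (unitBall n))
    (hφ : DifferentiableOn ℂ φ (unitBall n)) (hmaps : Set.MapsTo φ (unitBall n) (unitBall n))
    {z : Cn n} (hz : z ∈ unitBall n) {R S : ℝ} (hS : 0 ≤ S)
    (h1 : ‖T (BlochSpace.mk (testLog (φ z)))‖ ≤ R)
    (h2 : ‖ψ z‖ₑ * bigT φ z ≤ ENNReal.ofReal S) :
    blochQ ψ z * ENNReal.ofReal (logWeight (φ z) ^ 2 / (1 + logWeight (φ z)))
      ≤ ENNReal.ofReal (R + 36 * S) := by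
  have hR : 0 ≤ R := (norm_nonneg _).trans h1
  have hw := hmaps hz
  have hd : DifferentiableAt ℂ φ z := hφ.differentiableAt (Metric.isOpen_ball.mem_nhds hz)
  have h2' : ‖ψ z‖ * (bigT φ z).toReal ≤ S := by
    have := ENNReal.toReal_le_of_le_ofReal hS h2
    rwa [ENNReal.toReal_mul, toReal_enorm] at this
  have hB := isBloch_testLog hw
  rw [← norm_testLog_self hw]
  refine blochQ_mul_ofReal_le hz (norm_nonneg _) (by positivity) fun u => ?_
  have h3 := hT.fderiv_apply hψ hφ hmaps (BlochSpace.mk (testLog (φ z))) hz u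
  rw [BlochSpace.mk_apply hB hw,
    BlochSpace.fderiv_eq_of_eqOn (fun x hx => BlochSpace.mk_apply hB hx) hw] at h3
  have h4 := norm_fderiv_comp_le_bigT hz hd hw hB.1 (c := 36) (by norm_num)
    (fun x hx u => norm_fderiv_testLog_le hw hx u) u
  have h5 := (BlochSpace.norm_fderiv_le (T (BlochSpace.mk (testLog (φ z)))) hz u).trans
    (mul_le_mul_of_nonneg_right h1 (bergmanNorm_nonneg z u))
  -- The logarithmic test does not vanish at φ(z), so the product rule is solved for the ψ' term;
  -- `h2` controls the other one.
  have h6 : testLog (φ z) (φ z) * fderiv ℂ ψ z u = fderiv ℂ (T (BlochSpace.mk (testLog (φ z)))) z u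
      - ψ z * fderiv ℂ (testLog (φ z)) (φ z) (fderiv ℂ φ z u) := by
    rw [h3]
    ring
  have h7 : ‖ψ z‖ * ‖fderiv ℂ (testLog (φ z)) (φ z) (fderiv ℂ φ z u)‖
      ≤ 36 * S * bergmanNorm z u := by
    calc _ ≤ ‖ψ z‖ * (36 * (bigT φ z).toReal * bergmanNorm z u) := by gcongr
      _ = ‖ψ z‖ * (bigT φ z).toReal * (36 * bergmanNorm z u) := by ring
      _ ≤ S * (36 * bergmanNorm z u) := by
        have := bergmanNorm_nonneg z u
        gcongr
      _ = _ := by ring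
  calc ‖fderiv ℂ ψ z u‖ * ‖testLog (φ z) (φ z)‖
      = ‖testLog (φ z) (φ z) * fderiv ℂ ψ z u‖ := by rw [norm_mul, mul_comm]
    _ ≤ _ := by
      rw [h6]
      refine (norm_sub_le _ _).trans ?_
      rw [norm_mul]
      linarith

/-! ### Boundedness -/

/-- On the ball, ψ is the image of the constant function 1. -/
lemma IsWeightedComp.isBloch {T : BlochSpace n →L[ℂ] BlochSpace n}
    (hT : IsWeightedComp ψ φ T) (hψ : DifferentiableOn ℂ ψ (unitBall n))
    (hmaps : Set.MapsTo φ (unitBall n) (unitBall n)) : IsBloch ψ := by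
  have h1 : IsBloch (fun _ : Cn n => (1 : ℂ)) :=
    isBloch_of_le (differentiableOn_const _) le_rfl fun z _ u => by simp
  set g := T (BlochSpace.mk fun _ => 1)
  have h2 : ∀ z ∈ unitBall n, ψ z = g z := fun z hz => by
    rw [hT _ z hz, BlochSpace.mk_apply h1 (hmaps hz), mul_one]
  refine isBloch_of_le hψ (norm_nonneg g) fun z hz u => ?_
  rw [BlochSpace.fderiv_eq_of_eqOn h2 hz]
  exact g.norm_fderiv_le hz u

lemma IsWeightedComp.enorm_mul_bigT_le_opNorm {T : BlochSpace n →L[ℂ] BlochSpace n}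
    (hT : IsWeightedComp ψ φ T) (hψ : DifferentiableOn ℂ ψ (unitBall n))
    (hφ : DifferentiableOn ℂ φ (unitBall n)) (hmaps : Set.MapsTo φ (unitBall n) (unitBall n))
    {z : Cn n} (hz : z ∈ unitBall n) :
    ‖ψ z‖ₑ * bigT φ z ≤ ENNReal.ofReal (2 * (‖T‖ * 40)) :=
  hT.enorm_mul_bigT_le hψ hφ hmaps hz (T.le_opNorm_of_le (norm_mk_testRadial_le (hmaps hz)))
    fun _ hv => T.le_opNorm_of_le (norm_mk_testTangential_le (hmaps hz) hv)

lemma IsWeightedComp.tau_lt_top {T : BlochSpace n →L[ℂ] BlochSpace n}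
    (hT : IsWeightedComp ψ φ T) (hψ : DifferentiableOn ℂ ψ (unitBall n))
    (hφ : DifferentiableOn ℂ φ (unitBall n)) (hmaps : Set.MapsTo φ (unitBall n) (unitBall n)) :
    tau ψ φ < ∞ := by
  have h : tau ψ φ ≤ ENNReal.ofReal (2 * (‖T‖ * 40)) := by
    unfold tau
    exact iSup₂_le fun z hz => hT.enorm_mul_bigT_le_opNorm hψ hφ hmaps hz
  exact h.trans_lt ENNReal.ofReal_lt_top

/-- The test function gives the weight L²/(1 + L) ≥ L - 1, while ω ≤ 1 + L/2. The discrepancy is at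
most 3 and is paid for by β_ψ. -/
lemma IsWeightedComp.sigma_lt_top {T : BlochSpace n →L[ℂ] BlochSpace n}
    (hT : IsWeightedComp ψ φ T) (hψ : DifferentiableOn ℂ ψ (unitBall n))
    (hφ : DifferentiableOn ℂ φ (unitBall n)) (hmaps : Set.MapsTo φ (unitBall n) (unitBall n)) :
    sigma ψ φ < ∞ := by
  have hψB := hT.isBloch hψ hmaps
  refine (iSup₂_le (a := ENNReal.ofReal (‖T‖ * 40 + 36 * (2 * (‖T‖ * 40))) + blochBeta ψ * 3)
    fun z hz => ?_).trans_lt (ENNReal.add_lt_top.mpr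
      ⟨ENNReal.ofReal_lt_top, ENNReal.mul_lt_top hψB.2 (by simp)⟩)
  have hw := hmaps hz
  have hL := logWeight_nonneg hw
  have h1 := hT.blochQ_mul_le hψ hφ hmaps hz (by positivity)
    (T.le_opNorm_of_le (norm_mk_testLog_le hw)) (hT.enorm_mul_bigT_le_opNorm hψ hφ hmaps hz)
  have h2 : omega (φ z)
      ≤ ENNReal.ofReal (logWeight (φ z) ^ 2 / (1 + logWeight (φ z))) + 3 := by
    refine (omega_le_log hw).trans ?_
    have h3 : (3 : ℝ≥0∞) = ENNReal.ofReal 3 := by simp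
    rw [h3, ← ENNReal.ofReal_add (by positivity) (by norm_num)]
    refine ENNReal.ofReal_le_ofReal ?_
    have h4 := log_div_le_logWeight hw
    have h5 : logWeight (φ z) - 1 ≤ logWeight (φ z) ^ 2 / (1 + logWeight (φ z)) := by
      rw [le_div_iff₀ (by linarith)]
      nlinarith
    linarith
  have h6 : blochQ ψ z ≤ blochBeta ψ :=
    le_iSup₂ (f := fun (z : Cn n) (_ : z ∈ unitBall n) => blochQ ψ z) z hz
  calc _ ≤ (ENNReal.ofReal (logWeight (φ z) ^ 2 / (1 + logWeight (φ z))) + 3) * blochQ ψ z := by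
        gcongr
    _ = blochQ ψ z * ENNReal.ofReal (logWeight (φ z) ^ 2 / (1 + logWeight (φ z)))
        + blochQ ψ z * 3 := by ring
    _ ≤ _ := by gcongr

lemma norm_mul_bigT_le_tau (hτ : tau ψ φ < ∞) {z : Cn n} (hz : z ∈ unitBall n) :
    ‖ψ z‖ * (bigT φ z).toReal ≤ (tau ψ φ).toReal := by
  have := ENNReal.toReal_mono hτ.ne
    (le_iSup₂ (f := fun (z : Cn n) (_ : z ∈ unitBall n) => ‖ψ z‖ₑ * bigT φ z) z hz)
  rwa [ENNReal.toReal_mul, toReal_enorm] at this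

lemma omega_mul_blochQ_le_sigma (hσ : sigma ψ φ < ∞) {z : Cn n} (hz : z ∈ unitBall n) :
    (omega (φ z)).toReal * (blochQ ψ z).toReal ≤ (sigma ψ φ).toReal := by
  have := ENNReal.toReal_mono hσ.ne
    (le_iSup₂ (f := fun (z : Cn n) (_ : z ∈ unitBall n) => omega (φ z) * blochQ ψ z) z hz)
  rwa [ENNReal.toReal_mul] at this

/-- Splitting f(φ(z)) at f(0) leaves three terms, bounded through τ, β_ψ and σ respectively. -/
lemma norm_fderiv_weightedComp_le (hψ : IsBloch ψ)
    (hφ : DifferentiableOn ℂ φ (unitBall n)) (hmaps : Set.MapsTo φ (unitBall n) (unitBall n))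
    (hσ : sigma ψ φ < ∞) (hτ : tau ψ φ < ∞) (f : BlochSpace n) {z : Cn n} (hz : z ∈ unitBall n)
    (u : Cn n) :
    ‖fderiv ℂ (fun z => ψ z * f (φ z)) z u‖
      ≤ ((tau ψ φ).toReal + (blochBeta ψ).toReal + (sigma ψ φ).toReal) * ‖f‖
        * bergmanNorm z u := by
  have hw := hmaps hz
  have hd : DifferentiableAt ℂ φ z := hφ.differentiableAt (Metric.isOpen_ball.mem_nhds hz)
  have hh := bergmanNorm_nonneg z u
  have hf : ∀ x ∈ unitBall n, ∀ u, ‖fderiv ℂ f x u‖ ≤ ‖f‖ * bergmanNorm x u :=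
    fun x hx u => f.norm_fderiv_le hx u
  rw [fderiv_weightedComp hψ.1 hφ hmaps f.differentiableOn hz]
  have h1 : ‖ψ z * fderiv ℂ f (φ z) (fderiv ℂ φ z u)‖
      ≤ (tau ψ φ).toReal * (‖f‖ * bergmanNorm z u) := by
    rw [norm_mul]
    calc _ ≤ ‖ψ z‖ * (‖f‖ * (bigT φ z).toReal * bergmanNorm z u) := by
          gcongr
          exact norm_fderiv_comp_le_bigT hz hd hw f.differentiableOn (norm_nonneg f) hf u
      _ = ‖ψ z‖ * (bigT φ z).toReal * (‖f‖ * bergmanNorm z u) := by ring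
      _ ≤ _ := by
          gcongr
          exact norm_mul_bigT_le_tau hτ hz
  have h2 : ‖f 0‖ * ‖fderiv ℂ ψ z u‖ ≤ (blochBeta ψ).toReal * (‖f‖ * bergmanNorm z u) := by
    calc _ ≤ ‖f‖ * ((blochBeta ψ).toReal * bergmanNorm z u) := by
          gcongr
          · exact f.norm_apply_zero_le
          · exact hψ.norm_fderiv_le hz u
      _ = _ := by ring
  have h3 : ‖f (φ z) - f 0‖ * ‖fderiv ℂ ψ z u‖
      ≤ (sigma ψ φ).toReal * (‖f‖ * bergmanNorm z u) := by
    calc _ ≤ (‖f‖ * (omega (φ z)).toReal) * ((blochQ ψ z).toReal * bergmanNorm z u) := by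
          gcongr
          · exact norm_sub_zero_le_omega hw f.differentiableOn (norm_nonneg f) hf
          · exact hψ.norm_fderiv_le_blochQ hz u
      _ = (omega (φ z)).toReal * (blochQ ψ z).toReal * (‖f‖ * bergmanNorm z u) := by ring
      _ ≤ _ := by
          gcongr
          exact omega_mul_blochQ_le_sigma hσ hz
  have h4 : ‖f (φ z) * fderiv ℂ ψ z u‖
      ≤ ‖f 0‖ * ‖fderiv ℂ ψ z u‖ + ‖f (φ z) - f 0‖ * ‖fderiv ℂ ψ z u‖ := by
    rw [norm_mul, ← add_mul]
    gcongr
    exact norm_le_norm_add_norm_sub' _ _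
  refine (norm_add_le _ _).trans ?_
  linarith

lemma isBoundedWeightedComp_of_lt_top (hψ : IsBloch ψ)
    (hφ : DifferentiableOn ℂ φ (unitBall n)) (hmaps : Set.MapsTo φ (unitBall n) (unitBall n))
    (hσ : sigma ψ φ < ∞) (hτ : tau ψ φ < ∞) : IsBoundedWeightedComp ψ φ := by
  have hdiff : ∀ f : BlochSpace n, DifferentiableOn ℂ (fun z => ψ z * f (φ z)) (unitBall n) :=
    fun f => hψ.1.mul (f.differentiableOn.comp hφ hmaps)
  set C := (tau ψ φ).toReal + (blochBeta ψ).toReal + (sigma ψ φ).toReal with hC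
  have hC0 : 0 ≤ C := by positivity
  have hbound : ∀ f : BlochSpace n, ∀ z ∈ unitBall n, ∀ u,
      ‖fderiv ℂ (fun z => ψ z * f (φ z)) z u‖ ≤ C * ‖f‖ * bergmanNorm z u :=
    fun f z hz u => norm_fderiv_weightedComp_le hψ hφ hmaps hσ hτ f hz u
  have happly : ∀ f : BlochSpace n, ∀ z ∈ unitBall n,
      BlochSpace.mk (fun z => ψ z * f (φ z)) z = ψ z * f (φ z) := fun f z hz =>
    BlochSpace.mk_apply (isBloch_of_le (hdiff f) (by positivity) (hbound f)) hz
  let S : BlochSpace n →ₗ[ℂ] BlochSpace n :=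
    { toFun := fun f => BlochSpace.mk (fun z => ψ z * f (φ z))
      map_add' := fun f g => BlochSpace.ext_ball fun z hz => by
        rw [BlochSpace.add_apply, happly _ z hz, happly _ z hz, happly _ z hz,
          BlochSpace.add_apply, mul_add]
      map_smul' := fun c f => BlochSpace.ext_ball fun z hz => by
        rw [RingHom.id_apply, BlochSpace.smul_apply, happly _ z hz, happly _ z hz,
          BlochSpace.smul_apply, mul_left_comm] }
  refine ⟨S.mkContinuous (‖ψ 0‖ * (1 + 1 / 2 * Real.log ((1 + ‖φ 0‖) / (1 - ‖φ 0‖))) + C)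
    fun f => ?_, fun f z hz => happly f z hz⟩
  rw [add_mul]
  refine BlochSpace.norm_mk_le (hdiff f) ?_ (by positivity) (hbound f)
  rw [norm_mul, mul_assoc]
  gcongr
  exact f.norm_apply_le (hmaps (by simp))

end WeightedComp

/-! ### The boundary filter -/

section BoundaryFilter

variable {φ : Cn n → Cn n}

lemma eventually_mem_unitBall (φ : Cn n → Cn n) : ∀ᶠ z in boundaryFilter φ, z ∈ unitBall n :=
  mem_inf_of_right (mem_principal_self _)

lemma tendsto_norm_boundaryFilter (φ : Cn n → Cn n) :
    Tendsto (fun z => ‖φ z‖) (boundaryFilter φ) (𝓝[<] 1) :=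
  tendsto_comap.mono_left inf_le_left

lemma tendsto_one_sub_norm_sq (φ : Cn n → Cn n) :
    Tendsto (fun z => 1 - ‖φ z‖ ^ 2) (boundaryFilter φ) (𝓝[>] 0) := by
  refine tendsto_nhdsWithin_iff.mpr ⟨?_, ?_⟩
  · have h := (((tendsto_norm_boundaryFilter φ).mono_right nhdsWithin_le_nhds).pow 2).const_sub 1
    simpa using h
  · filter_upwards [(tendsto_norm_boundaryFilter φ).eventually self_mem_nhdsWithin] with z hz
    have h1 : ‖φ z‖ < 1 := hz
    have h2 := norm_nonneg (φ z)
    change 0 < 1 - ‖φ z‖ ^ 2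
    nlinarith

lemma tendsto_logWeight (φ : Cn n → Cn n) :
    Tendsto (fun z => logWeight (φ z)) (boundaryFilter φ) atTop :=
  tendsto_neg_atBot_atTop.comp (Real.tendsto_log_nhdsGT_zero.comp (tendsto_one_sub_norm_sq φ))

lemma exists_radius_of_eventually {p : Cn n → Prop} (h : ∀ᶠ z in boundaryFilter φ, p z) :
    ∃ r, 0 ≤ r ∧ r < 1 ∧ ∀ z ∈ unitBall n, r < ‖φ z‖ → ‖φ z‖ < 1 → p z := by
  rw [boundaryFilter, eventually_inf_principal, eventually_comap] at h
  obtain ⟨r, hr, hrs⟩ := mem_nhdsLT_iff_exists_Ioo_subset.mp h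
  refine ⟨max r 0, le_max_right _ _, max_lt hr one_pos, fun z hz h1 h2 => ?_⟩
  exact hrs ⟨(le_max_left _ _).trans_lt h1, h2⟩ z rfl hz

end BoundaryFilter

lemma tendsto_zero_of_eventually_le_ofReal {α : Type*} {l : Filter α} {f : α → ℝ≥0∞}
    (h : ∀ ε : ℝ, 0 < ε → ∀ᶠ a in l, f a ≤ ENNReal.ofReal ε) : Tendsto f l (𝓝 0) := by
  refine ENNReal.tendsto_nhds_zero.mpr fun ε hε => ?_
  by_cases hε' : ε = ∞
  · simp [hε']
  · have := h ε.toReal (ENNReal.toReal_pos hε.ne' hε')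
    rwa [ENNReal.ofReal_toReal hε'] at this

lemma eventually_le_ofReal {α : Type*} {l : Filter α} {f : α → ℝ≥0∞} (h : Tendsto f l (𝓝 0))
    {ε : ℝ} (hε : 0 < ε) : ∀ᶠ a in l, f a ≤ ENNReal.ofReal ε :=
  ENNReal.tendsto_nhds_zero.mp h _ (ENNReal.ofReal_pos.mpr hε)

/-! ### Necessity for compactness -/

section Compact

variable {ψ : Cn n → ℂ} {φ : Cn n → Cn n} {T : BlochSpace n →L[ℂ] BlochSpace n}

/-- A compact weighted composition operator sends bounded families converging pointwise to `0` to
families converging to `0` in norm. -/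
lemma IsWeightedComp.tendsto_zero_of_isCompactOperator (hT : IsWeightedComp ψ φ T)
    (hmaps : Set.MapsTo φ (unitBall n) (unitBall n)) (hc : IsCompactOperator T) {α : Type*}
    {l : Filter α} {F : α → BlochSpace n} {C : ℝ} (hF : ∀ᶠ a in l, ‖F a‖ ≤ C)
    (hpt : ∀ x ∈ unitBall n, Tendsto (fun a => F a x) l (𝓝 0)) :
    Tendsto (fun a => T (F a)) l (𝓝 0) := by
  obtain ⟨K, hK, hKs⟩ := IsCompactOperator.image_closedBall_subset_compact
    (f := (T : BlochSpace n →ₗ[ℂ] BlochSpace n)) hc C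
  -- The images eventually stay in a compact set, so it suffices that every cluster point y is 0.
  -- Evaluations are continuous, so y(z) is a cluster point of ψ(z) F_a(φ(z)), which tends to 0.
  refine hK.tendsto_nhds_of_unique_mapClusterPt
    (hF.mono fun a ha => hKs ⟨F a, by simpa using ha, rfl⟩) fun y _ hy => ?_
  refine BlochSpace.ext_ball fun z hz => ?_
  have h1 : MapClusterPt (y z) l fun a => T (F a) z :=
    hy.continuousAt_comp (f := BlochSpace.eval z hz) (BlochSpace.eval z hz).continuous.continuousAt
  have h2 : Tendsto (fun a => T (F a) z) l (𝓝 0) := by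
    have := (hpt (φ z) (hmaps hz)).const_mul (ψ z)
    rw [mul_zero] at this
    exact this.congr fun a => (hT (F a) z hz).symm
  have h3 : ClusterPt (y z) (𝓝 0) := ClusterPt.mono h1 h2
  exact eq_of_nhds_neBot h3

lemma IsWeightedComp.tendsto_testRadial (hT : IsWeightedComp ψ φ T)
    (hmaps : Set.MapsTo φ (unitBall n) (unitBall n)) (hc : IsCompactOperator T) :
    Tendsto (fun z => T (BlochSpace.mk (testRadial (φ z)))) (boundaryFilter φ) (𝓝 0) := by
  refine hT.tendsto_zero_of_isCompactOperator hmaps hc (C := 40)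
    ((eventually_mem_unitBall φ).mono fun z hz => norm_mk_testRadial_le (hmaps hz)) fun x hx => ?_
  refine squeeze_zero_norm' ((eventually_mem_unitBall φ).mono fun z hz => ?_)
    (a := fun z => 3 * ((1 - ‖φ z‖ ^ 2) / (1 - ‖x‖))) ?_
  · rw [BlochSpace.mk_apply (isBloch_testRadial (hmaps hz)) hx]
    exact norm_testRadial_le (hmaps hz) hx
  · have := ((tendsto_nhdsWithin_iff.mp (tendsto_one_sub_norm_sq φ)).1.div_const
      (1 - ‖x‖)).const_mul 3
    simpa using this

/-- The direction to be tested depends on u as well as on z, so convergence has to be uniform in v;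
the product with a principal filter expresses this. -/
lemma IsWeightedComp.tendsto_testTangential (hT : IsWeightedComp ψ φ T)
    (hmaps : Set.MapsTo φ (unitBall n) (unitBall n)) (hc : IsCompactOperator T) :
    Tendsto (fun p : Cn n × Cn n => T (BlochSpace.mk (testTangential (φ p.1) p.2)))
      (boundaryFilter φ ×ˢ 𝓟 {v | ‖v‖ ≤ 1}) (𝓝 0) := by
  have hmem : ∀ᶠ p : Cn n × Cn n in boundaryFilter φ ×ˢ 𝓟 {v | ‖v‖ ≤ 1},
      p.1 ∈ unitBall n ∧ ‖p.2‖ ≤ 1 :=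
    (eventually_mem_unitBall φ).prod_mk (mem_principal_self {v : Cn n | ‖v‖ ≤ 1})
  refine hT.tendsto_zero_of_isCompactOperator hmaps hc (C := 40)
    (hmem.mono fun p hp => norm_mk_testTangential_le (hmaps hp.1) hp.2) fun x hx => ?_
  refine squeeze_zero_norm' (hmem.mono fun p hp => ?_)
    (a := fun p => √(1 - ‖φ p.1‖ ^ 2) * (2 / (1 - ‖x‖))) ?_
  · rw [BlochSpace.mk_apply (isBloch_testTangential (hmaps hp.1) hp.2) hx]
    exact norm_testTangential_le (hmaps hp.1) hx hp.2
  · have := (((tendsto_nhdsWithin_iff.mp (tendsto_one_sub_norm_sq φ)).1.sqrt).mul_const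
      (2 / (1 - ‖x‖))).comp (tendsto_fst (g := 𝓟 {v : Cn n | ‖v‖ ≤ 1}))
    simpa [Function.comp_def] using this

lemma IsWeightedComp.tendsto_testLog (hT : IsWeightedComp ψ φ T)
    (hmaps : Set.MapsTo φ (unitBall n) (unitBall n)) (hc : IsCompactOperator T) :
    Tendsto (fun z => T (BlochSpace.mk (testLog (φ z)))) (boundaryFilter φ) (𝓝 0) := by
  refine hT.tendsto_zero_of_isCompactOperator hmaps hc (C := 40)
    ((eventually_mem_unitBall φ).mono fun z hz => norm_mk_testLog_le (hmaps hz)) fun x hx => ?_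
  refine squeeze_zero_norm' ((eventually_mem_unitBall φ).mono fun z hz => ?_)
    (a := fun z => (5 - Real.log (1 - ‖x‖)) ^ 2 / (1 + logWeight (φ z))) ?_
  · rw [BlochSpace.mk_apply (isBloch_testLog (hmaps hz)) hx]
    exact norm_testLog_le (hmaps hz) hx
  · exact (tendsto_atTop_add_const_left _ 1 (tendsto_logWeight φ)).const_div_atTop _

lemma eventually_norm_le {α : Type*} {l : Filter α} {F : α → BlochSpace n}
    (h : Tendsto F l (𝓝 0)) {ε : ℝ} (hε : 0 < ε) : ∀ᶠ a in l, ‖F a‖ ≤ ε := by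
  have := h.norm
  rw [norm_zero] at this
  exact (this.eventually_lt_const hε).mono fun _ => le_of_lt

lemma IsWeightedComp.tendsto_enorm_mul_bigT (hT : IsWeightedComp ψ φ T)
    (hψ : DifferentiableOn ℂ ψ (unitBall n)) (hφ : DifferentiableOn ℂ φ (unitBall n))
    (hmaps : Set.MapsTo φ (unitBall n) (unitBall n)) (hc : IsCompactOperator T) :
    Tendsto (fun z => ‖ψ z‖ₑ * bigT φ z) (boundaryFilter φ) (𝓝 0) := by
  refine tendsto_zero_of_eventually_le_ofReal fun ε hε => ?_
  have h2 := eventually_prod_principal_iff.mp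
    (eventually_norm_le (hT.tendsto_testTangential hmaps hc) (half_pos hε))
  filter_upwards [eventually_mem_unitBall φ,
    eventually_norm_le (hT.tendsto_testRadial hmaps hc) (half_pos hε), h2] with z hz h3 h4
  refine (hT.enorm_mul_bigT_le hψ hφ hmaps hz h3 fun v hv => h4 v hv).trans (le_of_eq ?_)
  rw [mul_div_cancel₀ ε two_ne_zero]

lemma IsWeightedComp.tendsto_blochQ_mul_log (hT : IsWeightedComp ψ φ T)
    (hψ : DifferentiableOn ℂ ψ (unitBall n)) (hφ : DifferentiableOn ℂ φ (unitBall n))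
    (hmaps : Set.MapsTo φ (unitBall n) (unitBall n)) (hc : IsCompactOperator T) :
    Tendsto (fun z => blochQ ψ z * ENNReal.ofReal (Real.log ((1 + ‖φ z‖) / (1 - ‖φ z‖))))
      (boundaryFilter φ) (𝓝 0) := by
  refine tendsto_zero_of_eventually_le_ofReal fun ε hε => ?_
  -- 222 = 6 · (1 + 36): the factor 6 is from `h4`, the 36 from `blochQ_mul_le`.
  have hδ : 0 < ε / 222 := by positivity
  filter_upwards [eventually_mem_unitBall φ,
    eventually_norm_le (hT.tendsto_testLog hmaps hc) hδ,
    eventually_le_ofReal (hT.tendsto_enorm_mul_bigT hψ hφ hmaps hc) hδ,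
    (tendsto_logWeight φ).eventually_ge_atTop 1] with z hz h1 h2 hL
  have h3 := hT.blochQ_mul_le hψ hφ hmaps hz hδ.le h1 h2
  -- For L ≥ 1, (2 + L)(1 + L) ≤ 6L².
  have h4 : Real.log ((1 + ‖φ z‖) / (1 - ‖φ z‖))
      ≤ 6 * (logWeight (φ z) ^ 2 / (1 + logWeight (φ z))) := by
    refine (log_div_le_logWeight (hmaps hz)).trans ?_
    rw [← mul_div_assoc, le_div_iff₀ (by linarith)]
    nlinarith
  calc _ ≤ blochQ ψ z
        * ENNReal.ofReal (6 * (logWeight (φ z) ^ 2 / (1 + logWeight (φ z)))) := by gcongr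
    _ = ENNReal.ofReal 6 * (blochQ ψ z
        * ENNReal.ofReal (logWeight (φ z) ^ 2 / (1 + logWeight (φ z)))) := by
      rw [ENNReal.ofReal_mul (by norm_num)]
      ring
    _ ≤ ENNReal.ofReal 6 * ENNReal.ofReal (ε / 222 + 36 * (ε / 222)) := by gcongr
    _ = _ := by
      rw [← ENNReal.ofReal_mul (by norm_num)]
      congr 1
      ring

end Compact

/-! ### Pointwise limits of bounded families of Bloch functions -/

/-- K and δ do not depend on f, so the inequality survives pointwise limits of values and
derivatives. Cauchy's estimate applied to differences of translates of f makes f' Lipschitz near x,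
and the mean value inequality concludes. -/
lemma exists_taylor_bound {c : ℝ} (hc : 0 ≤ c) {x : Cn n} (hx : x ∈ unitBall n) :
    ∃ K δ : ℝ, 0 < δ ∧ ∀ f : Cn n → ℂ, DifferentiableOn ℂ f (unitBall n) →
      (∀ z ∈ unitBall n, ∀ u, ‖fderiv ℂ f z u‖ ≤ c * bergmanNorm z u) →
      ∀ y, ‖y - x‖ ≤ δ → ‖f y - f x - fderiv ℂ f x (y - x)‖ ≤ K * ‖y - x‖ ^ 2 := by
  have hx1 := norm_lt_one_of_mem hx
  set δ := (1 - ‖x‖) / 3 with hδdef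
  have hδ : 0 < δ := by rw [hδdef]; linarith
  -- Two steps of length δ are needed, one for the translation and one for the Cauchy disc; s = 1 -
  -- δ leaves room for both.
  set s := ‖x‖ + 2 * δ with hsdef
  have hs1 : s < 1 := by rw [hsdef, hδdef]; linarith
  have hs0 : 0 ≤ s := by positivity
  have hA : 0 < 1 - s ^ 2 := by nlinarith
  set L := c / (1 - s ^ 2)
  have hL : 0 ≤ L := by positivity
  refine ⟨L / δ, δ, hδ, fun f hf hb y hy => ?_⟩
  have hball : ∀ p : Cn n, ‖p - x‖ ≤ 2 * δ → ‖p‖ ≤ s := fun p hp => by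
    linarith [norm_le_norm_add_norm_sub' p x]
  have hdiff : ∀ p : Cn n, ‖p - x‖ ≤ 2 * δ → DifferentiableAt ℂ f p := fun p hp =>
    differentiableAt_of_mem hf (by simpa using (hball p hp).trans_lt hs1)
  have hlip : ∀ p : Cn n, ‖p - x‖ ≤ δ →
      ‖fderiv ℂ f p - fderiv ℂ f x‖ ≤ L / δ * ‖p - x‖ := by
    intro p hp
    refine ContinuousLinearMap.opNorm_le_bound _ (by positivity) fun u => ?_
    by_cases hu : u = 0
    · simp [hu]
    have hu' : 0 < ‖u‖ := norm_pos_iff.mpr hu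
    have hder : fderiv ℂ (fun q => f (q + (p - x)) - f q) x = fderiv ℂ f p - fderiv ℂ f x := by
      have h1 : DifferentiableAt ℂ f (x + (p - x)) :=
        hdiff _ (by rw [add_sub_cancel_left]; linarith)
      rw [fderiv_fun_sub ((differentiableAt_comp_add_right _).mpr h1)
        (hdiff x (by simpa using hδ.le)), fderiv_comp_add_right, add_sub_cancel]
    rw [← hder]
    have hcu : ∀ a : ℂ, ‖a‖ ≤ δ / ‖u‖ → ‖a • u‖ ≤ δ := fun a ha => by
      rw [norm_smul]
      exact (le_div_iff₀ hu').mp ha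
    refine (norm_fderiv_apply_le_of_disc (M := L * ‖p - x‖) (r := δ / ‖u‖) (by positivity)
      fun a ha => ?_).trans (le_of_eq ?_)
    · have h1 : ‖x + a • u - x‖ ≤ 2 * δ := by
        rw [add_sub_cancel_left]
        linarith [hcu a ha]
      have h2 : ‖x + a • u + (p - x) - x‖ ≤ 2 * δ := by
        have : x + a • u + (p - x) - x = a • u + (p - x) := by abel
        rw [this]
        linarith [norm_add_le (a • u) (p - x), hcu a ha]
      refine ⟨((differentiableAt_comp_add_right _).mpr (hdiff _ h2)).fun_sub (hdiff _ h1), ?_⟩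
      have h3 := norm_sub_le_of_bergman hf hc hb hs1 (hball _ h1) (hball _ h2)
      rwa [add_sub_cancel_left] at h3
    · field_simp
  have key := (convex_closedBall x ‖y - x‖).norm_image_sub_le_of_norm_fderiv_le' (𝕜 := ℂ)
    (f := f) (φ := fderiv ℂ f x) (C := L / δ * ‖y - x‖)
    (fun p hp => hdiff p (by
      have := mem_closedBall_iff_norm.mp hp
      linarith))
    (fun p hp => by
      have := mem_closedBall_iff_norm.mp hp
      refine (hlip p (this.trans hy)).trans ?_
      gcongr)
    (Metric.mem_closedBall_self (norm_nonneg _)) (mem_closedBall_iff_norm.mpr le_rfl)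
  calc _ ≤ _ := key
    _ = _ := by ring

lemma hasFDerivAt_of_taylor_bound {f : Cn n → ℂ} {A : Cn n →L[ℂ] ℂ} {x : Cn n} {K δ : ℝ}
    (hδ : 0 < δ) (h : ∀ y, ‖y - x‖ ≤ δ → ‖f y - f x - A (y - x)‖ ≤ K * ‖y - x‖ ^ 2) :
    HasFDerivAt f A x := by
  have h1 : (fun y => f y - f x - A (y - x)) =O[𝓝 x] fun y => ‖y - x‖ ^ 2 := by
    refine Asymptotics.IsBigO.of_bound K ?_
    filter_upwards [Metric.closedBall_mem_nhds x hδ] with y hy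
    simpa using h y (mem_closedBall_iff_norm.mp hy)
  have h2 := (h1.hasFDerivAt one_lt_two).add
    ((A.hasFDerivAt.comp x ((hasFDerivAt_id x).sub_const x)).add_const (f x))
  refine (h2.congr_of_eventuallyEq (.of_forall fun y => ?_)).congr_fderiv ?_
  · simp
    ring
  · ext u
    simp

/-- Bounded families of Bloch functions have pointwise limits along ultrafilters. -/
lemma exists_bloch_limit {C : ℝ} (G : Ultrafilter (BlochSpace n)) 
    (hG : ∀ᶠ f in (G : Filter (BlochSpace n)), ‖f‖ ≤ C) :
    ∃ g : BlochSpace n, ‖g‖ ≤ C ∧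
      ∀ x ∈ unitBall n, Tendsto (fun f : BlochSpace n => f x) G (𝓝 (g x)) := by
  have hC : 0 ≤ C := by
    obtain ⟨f, hf⟩ := hG.exists
    exact (norm_nonneg f).trans hf
  -- Values, and below derivatives, lie in compact balls of finite-dimensional spaces, so they
  -- converge along the ultrafilter. The membership condition is kept inside so that `choose` gives
  -- total functions.
  have hval : ∀ x : Cn n, ∃ a : ℂ, x ∈ unitBall n →
      Tendsto (fun f : BlochSpace n => f x) G (𝓝 a) := by
    intro x
    by_cases hx : x ∈ unitBall n
    · have h0 : 0 ≤ 1 + 1 / 2 * Real.log ((1 + ‖x‖) / (1 - ‖x‖)) := by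
        have := log_div_nonneg (norm_nonneg x) (norm_lt_one_of_mem hx)
        positivity
      obtain ⟨a, -, ha⟩ := (isCompact_closedBall (0 : ℂ)
        ((1 + 1 / 2 * Real.log ((1 + ‖x‖) / (1 - ‖x‖))) * C)).ultrafilter_le_nhds
        (G.map fun f : BlochSpace n => f x) (le_principal_iff.mpr (hG.mono fun f hf => by
          refine mem_closedBall_zero_iff.mpr ((f.norm_apply_le hx).trans ?_)
          gcongr))
      exact ⟨a, fun _ => ha⟩
    · exact ⟨0, fun h => absurd h hx⟩
  have hder : ∀ x : Cn n, ∃ A : Cn n →L[ℂ] ℂ, x ∈ unitBall n →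
      Tendsto (fun f : BlochSpace n => fderiv ℂ f x) G (𝓝 A) := by
    intro x
    have : ProperSpace (Cn n →L[ℂ] ℂ) := FiniteDimensional.proper ℂ _
    by_cases hx : x ∈ unitBall n
    · obtain ⟨A, -, hA⟩ := (isCompact_closedBall (0 : Cn n →L[ℂ] ℂ)
        (C / (1 - ‖x‖ ^ 2))).ultrafilter_le_nhds
        (G.map fun f : BlochSpace n => fderiv ℂ f x) (le_principal_iff.mpr (hG.mono fun f hf => by
          refine mem_closedBall_zero_iff.mpr ((norm_fderiv_le_of_bergman (norm_nonneg f)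
            (fun z hz u => f.norm_fderiv_le hz u) (norm_lt_one_of_mem hx) le_rfl).trans ?_)
          have := one_sub_norm_sq_pos hx
          gcongr))
      exact ⟨A, fun _ => hA⟩
    · exact ⟨0, fun h => absurd h hx⟩
  choose g hg using hval
  choose A hA using hder
  -- The uniform Taylor inequality passes to the limit, so the limit of the derivatives is the
  -- derivative of the limit.
  have hgA : ∀ x ∈ unitBall n, HasFDerivAt g (A x) x := by
    intro x hx
    obtain ⟨K, δ, hδ, h⟩ := exists_taylor_bound hC hx
    have hmem : ∀ᶠ y in 𝓝 x, y ∈ unitBall n := Metric.isOpen_ball.eventually_mem hx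
    obtain ⟨δ', hδ', hsub⟩ := Metric.nhds_basis_closedBall.mem_iff.mp hmem
    refine hasFDerivAt_of_taylor_bound (K := K) (lt_min hδ hδ') fun y hy => ?_
    have hy' : y ∈ unitBall n :=
      hsub (mem_closedBall_iff_norm.mpr (hy.trans (min_le_right _ _)))
    have hev : ∀ u, Tendsto (fun f : BlochSpace n => fderiv ℂ f x u) G (𝓝 (A x u)) := fun u =>
      ((ContinuousLinearMap.apply ℂ ℂ u).continuous.tendsto _).comp (hA x hx)
    refine le_of_tendsto ((((hg y hy').sub (hg x hx)).sub (hev (y - x))).norm)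
      (hG.mono fun f hf => h f f.differentiableOn (fun z hz u => ?_) y (hy.trans (min_le_left _ _)))
    refine (f.norm_fderiv_le hz u).trans ?_
    have := bergmanNorm_nonneg z u
    gcongr
  have hd : DifferentiableOn ℂ g (unitBall n) := fun x hx =>
    (hgA x hx).differentiableAt.differentiableWithinAt
  have h0 : (0 : Cn n) ∈ unitBall n := by simp
  -- The seminorm is bounded by C - ‖g 0‖ rather than by C, so that the full norm of the limit is at
  -- most C.
  have hbound : ∀ z ∈ unitBall n, ∀ u,
      ‖fderiv ℂ g z u‖ ≤ (C - ‖g 0‖) * bergmanNorm z u := by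
    intro z hz u
    rw [(hgA z hz).fderiv]
    have hev : Tendsto (fun f : BlochSpace n => fderiv ℂ f z u) G (𝓝 (A z u)) :=
      ((ContinuousLinearMap.apply ℂ ℂ u).continuous.tendsto _).comp (hA z hz)
    refine le_of_tendsto_of_tendsto hev.norm
      (((hg 0 h0).norm.const_sub C).mul_const (bergmanNorm z u)) (hG.mono fun f hf => ?_)
    refine (f.2.1.norm_fderiv_le hz u).trans ?_
    have := bergmanNorm_nonneg z u
    have h1 := f.norm_eq
    have h2 : (blochBeta f.1).toReal ≤ C - ‖f 0‖ := by linarith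
    exact mul_le_mul_of_nonneg_right h2 this
  have hg0 : ‖g 0‖ ≤ C :=
    le_of_tendsto (hg 0 h0).norm (hG.mono fun f hf => f.norm_apply_zero_le.trans hf)
  refine ⟨BlochSpace.mk g, ?_, fun x hx => ?_⟩
  · refine (BlochSpace.norm_mk_le hd le_rfl (sub_nonneg.mpr hg0) hbound).trans (le_of_eq ?_)
    ring
  · rw [BlochSpace.mk_apply (isBloch_of_le hd (sub_nonneg.mpr hg0) hbound) hx]
    exact hg x hx

/-- Bounded families of Bloch functions converging pointwise to `0` converge uniformly on smaller
balls. -/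
lemma eventually_uniform_small {α : Type*} {l : Filter α} {F : α → BlochSpace n} {C : ℝ}
    (hF : ∀ᶠ a in l, ‖F a‖ ≤ C) (hpt : ∀ x ∈ unitBall n, Tendsto (fun a => F a x) l (𝓝 0))
    {r : ℝ} (hr0 : 0 ≤ r) (hr : r < 1) {ε : ℝ} (hε : 0 < ε) :
    ∀ᶠ a in l, ∀ x : Cn n, ‖x‖ ≤ r → ‖F a x‖ ≤ ε := by
  by_cases hC : 0 ≤ C
  swap
  · exact hF.mono fun a ha => absurd ((norm_nonneg _).trans ha) hC
  have hA : 0 < 1 - r ^ 2 := by nlinarith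
  set K := C / (1 - r ^ 2)
  have hK : 0 ≤ K := by positivity
  -- All but a null part of the family is K-Lipschitz on the ball of radius r, so smallness on a
  -- finite net suffices; K + 1 avoids division by zero.
  obtain ⟨t, hts, htf, hcov⟩ := (isCompact_closedBall (0 : Cn n) r).finite_cover_balls
    (e := ε / (2 * (K + 1))) (by positivity)
  have ht : ∀ᶠ a in l, ∀ y ∈ t, ‖F a y‖ < ε / 2 := by
    refine (eventually_all_finite htf).mpr fun y hy => ?_
    have hy' : ‖y‖ ≤ r := by simpa using hts hy
    have := (hpt y (by simpa using hy'.trans_lt hr)).norm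
    rw [norm_zero] at this
    exact this.eventually_lt_const (half_pos hε)
  filter_upwards [ht, hF] with a ha hFa x hx
  obtain ⟨y, hy, hxy⟩ := Set.mem_iUnion₂.mp (hcov (mem_closedBall_zero_iff.mpr hx))
  have hy' : ‖y‖ ≤ r := by simpa using hts hy
  have h1 := norm_sub_le_of_bergman (F a).differentiableOn (norm_nonneg _)
    (fun z hz u => (F a).norm_fderiv_le hz u) hr hy' hx
  have h2 : ‖x - y‖ ≤ ε / (2 * (K + 1)) := (mem_ball_iff_norm.mp hxy).le
  have h3 : ‖F a x - F a y‖ ≤ ε / 2 := by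
    calc _ ≤ _ := h1
      _ ≤ C / (1 - r ^ 2) * (ε / (2 * (K + 1))) := by gcongr
      _ ≤ (K + 1) * (ε / (2 * (K + 1))) := by gcongr; linarith
      _ = _ := by field_simp
  linarith [norm_le_norm_add_norm_sub' (F a x) (F a y), ha y hy]

/-! ### Sufficiency for compactness -/

section Compact

variable {ψ : Cn n → ℂ} {φ : Cn n → Cn n} {T : BlochSpace n →L[ℂ] BlochSpace n}

/-- If the boundary conditions hold, bounded families converging pointwise to `0` are sent to
families converging to `0` in norm. -/
lemma IsWeightedComp.tendsto_zero_of_boundary (hT : IsWeightedComp ψ φ T)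
    (hψ : DifferentiableOn ℂ ψ (unitBall n)) (hφ : DifferentiableOn ℂ φ (unitBall n))
    (hmaps : Set.MapsTo φ (unitBall n) (unitBall n))
    (hb₁ : Tendsto (fun z => ‖ψ z‖ₑ * bigT φ z) (boundaryFilter φ) (𝓝 0))
    (hb₂ : Tendsto (fun z => blochQ ψ z *
      ENNReal.ofReal (Real.log ((1 + ‖φ z‖) / (1 - ‖φ z‖)))) (boundaryFilter φ) (𝓝 0))
    {α : Type*} {l : Filter α} {F : α → BlochSpace n} {C : ℝ} (hC : 0 ≤ C)
    (hF : ∀ᶠ a in l, ‖F a‖ ≤ C)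
    (hpt : ∀ x ∈ unitBall n, Tendsto (fun a => F a x) l (𝓝 0)) :
    Tendsto (fun a => T (F a)) l (𝓝 0) := by
  have hψB := hT.isBloch hψ hmaps
  have hτ := hT.tau_lt_top hψ hφ hmaps
  set b := (blochBeta ψ).toReal with hbdef
  set t := (tau ψ φ).toReal with htdef
  have hb0 : 0 ≤ b := ENNReal.toReal_nonneg
  have ht0 : 0 ≤ t := ENNReal.toReal_nonneg
  -- Near the boundary the terms cost C (gradient), b (value at 0) and C (oscillation); in the
  -- interior, 24t (gradient) and b (value).
  set M := C + b + C + 24 * t with hM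
  have hM0 : 0 ≤ M := by positivity
  rw [tendsto_zero_iff_norm_tendsto_zero]
  refine (tendsto_order.mpr ⟨fun ε hε => .of_forall fun a => hε.trans_le (norm_nonneg _),
    fun ε hε => ?_⟩)
  set η := ε / (2 * (‖ψ 0‖ + M + 1)) with hη
  have hη0 : 0 < η := by positivity
  obtain ⟨r, hr0, hr1, hr⟩ := exists_radius_of_eventually
    ((eventually_le_ofReal hb₁ hη0).and (eventually_le_ofReal hb₂ hη0))
  set s := (1 + r) / 2 with hs
  have hrs : r < s := by rw [hs]; linarith
  have hs1 : s < 1 := by rw [hs]; linarith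
  have hsr : 0 < s - r := by linarith
  have h0ball : (0 : Cn n) ∈ unitBall n := by simp
  have hφ0 : ∀ᶠ a in l, ‖F a (φ 0)‖ < η := by
    have := (hpt (φ 0) (hmaps h0ball)).norm
    rw [norm_zero] at this
    exact this.eventually_lt_const hη0
  -- Smallness η(s - r) on radius s gives, by Cauchy's estimate, gradients of size at most η on
  -- radius r.
  filter_upwards [hF, hφ0, eventually_uniform_small hF hpt (hr0.trans hrs.le) hs1
    (mul_pos hη0 hsr)] with a hFa h0a hua
  have hua' : ∀ x : Cn n, ‖x‖ ≤ s → ‖F a x‖ ≤ η := fun x hx =>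
    (hua x hx).trans (mul_le_of_le_one_right hη0.le (by linarith))
  have hder : ∀ z ∈ unitBall n, ∀ u, ‖fderiv ℂ (T (F a)) z u‖ ≤ η * M * bergmanNorm z u := by
    intro z hz u
    have hw := hmaps hz
    have hw1 := norm_lt_one_of_mem hw
    have hd : DifferentiableAt ℂ φ z := hφ.differentiableAt (Metric.isOpen_ball.mem_nhds hz)
    have hh := bergmanNorm_nonneg z u
    rw [hT.fderiv_apply hψ hφ hmaps (F a) hz u]
    have hbQ : ‖fderiv ℂ ψ z u‖ ≤ b * bergmanNorm z u := hψB.norm_fderiv_le hz u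
    suffices h : ‖ψ z‖ * ‖fderiv ℂ (F a) (φ z) (fderiv ℂ φ z u)‖
        + ‖F a (φ z)‖ * ‖fderiv ℂ ψ z u‖ ≤ η * M * bergmanNorm z u by
      refine (norm_add_le _ _).trans ?_
      rwa [norm_mul, norm_mul]
    have hηh : 0 ≤ η * bergmanNorm z u := by positivity
    by_cases hrz : r < ‖φ z‖
    · obtain ⟨h1, h2⟩ := hr z hz hrz hw1
      have h1' : ‖ψ z‖ * (bigT φ z).toReal ≤ η := by
        have := ENNReal.toReal_le_of_le_ofReal hη0.le h1
        rwa [ENNReal.toReal_mul, toReal_enorm] at this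
      have hlog := log_div_nonneg (norm_nonneg (φ z)) hw1
      have h2' : (blochQ ψ z).toReal * Real.log ((1 + ‖φ z‖) / (1 - ‖φ z‖)) ≤ η := by
        have := ENNReal.toReal_le_of_le_ofReal hη0.le h2
        rwa [ENNReal.toReal_mul, ENNReal.toReal_ofReal hlog] at this
      set ℓ := Real.log ((1 + ‖φ z‖) / (1 - ‖φ z‖))
      have h3 : ‖ψ z‖ * ‖fderiv ℂ (F a) (φ z) (fderiv ℂ φ z u)‖
          ≤ C * (η * bergmanNorm z u) := by
        calc _ ≤ ‖ψ z‖ * (‖F a‖ * (bigT φ z).toReal * bergmanNorm z u) := by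
              gcongr
              exact norm_fderiv_comp_le_bigT hz hd hw (F a).differentiableOn (norm_nonneg _)
                (fun x hx u => (F a).norm_fderiv_le hx u) u
          _ = ‖F a‖ * (‖ψ z‖ * (bigT φ z).toReal * bergmanNorm z u) := by ring
          _ ≤ _ := by gcongr
      have h4 : ‖F a 0‖ * ‖fderiv ℂ ψ z u‖ ≤ b * (η * bergmanNorm z u) := by
        calc _ ≤ η * (b * bergmanNorm z u) := by
              gcongr
              exact hua' 0 (by simpa using hr0.trans hrs.le)
          _ = _ := by ring
      have h5 : ‖F a (φ z) - F a 0‖ * ‖fderiv ℂ ψ z u‖ ≤ C * (η * bergmanNorm z u) := by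
        calc _ ≤ (‖F a‖ * (1 / 2 * ℓ)) * ((blochQ ψ z).toReal * bergmanNorm z u) := by
              gcongr
              · exact (F a).norm_sub_zero_le hw
              · exact hψB.norm_fderiv_le_blochQ hz u
          _ = 1 / 2 * (‖F a‖ * ((blochQ ψ z).toReal * ℓ * bergmanNorm z u)) := by ring
          _ ≤ 1 * (C * (η * bergmanNorm z u)) := by gcongr; norm_num
          _ = _ := one_mul _
      have h6 : ‖F a (φ z)‖ * ‖fderiv ℂ ψ z u‖
          ≤ ‖F a 0‖ * ‖fderiv ℂ ψ z u‖ + ‖F a (φ z) - F a 0‖ * ‖fderiv ℂ ψ z u‖ := by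
        rw [← add_mul]
        gcongr
        exact norm_le_norm_add_norm_sub' _ _
      have h7 : η * M * bergmanNorm z u = C * (η * bergmanNorm z u) + b * (η * bergmanNorm z u)
          + C * (η * bergmanNorm z u) + 24 * t * (η * bergmanNorm z u) := by
        rw [hM]
        ring
      have h8 : 0 ≤ 24 * t * (η * bergmanNorm z u) := by positivity
      linarith
    · have hrz' : ‖φ z‖ ≤ r := not_lt.mp hrz
      have h3 : ‖ψ z‖ * ‖fderiv ℂ (F a) (φ z) (fderiv ℂ φ z u)‖
          ≤ 24 * t * (η * bergmanNorm z u) := by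
        calc _ ≤ ‖ψ z‖ * (η * (24 * (bigT φ z).toReal * bergmanNorm z u)) := by
              gcongr
              refine (norm_fderiv_apply_le_of_ball (F a).differentiableOn hrs hs1 hua hrz'
                _).trans ?_
              rw [mul_div_cancel_right₀ _ hsr.ne']
              gcongr
              exact (norm_le_bergmanNorm hw _).trans (bergmanNorm_le_bigT hz hd hw u)
          _ = ‖ψ z‖ * (bigT φ z).toReal * (24 * (η * bergmanNorm z u)) := by ring
          _ ≤ t * (24 * (η * bergmanNorm z u)) := by
              gcongr
              exact norm_mul_bigT_le_tau hτ hz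
          _ = _ := by ring
      have h4 : ‖F a (φ z)‖ * ‖fderiv ℂ ψ z u‖ ≤ b * (η * bergmanNorm z u) := by
        calc _ ≤ η * (b * bergmanNorm z u) := by
              gcongr
              exact hua' _ (hrz'.trans hrs.le)
          _ = _ := by ring
      have h7 : η * M * bergmanNorm z u = 2 * C * (η * bergmanNorm z u)
          + b * (η * bergmanNorm z u) + 24 * t * (η * bergmanNorm z u) := by
        rw [hM]
        ring
      have h8 : 0 ≤ 2 * C * (η * bergmanNorm z u) := by positivity
      linarith
  have hval : ‖T (F a) 0‖ ≤ ‖ψ 0‖ * η := by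
    rw [hT (F a) 0 h0ball, norm_mul]
    gcongr
  calc ‖T (F a)‖ ≤ ‖ψ 0‖ * η + η * M :=
        BlochSpace.norm_le_add _ hval (by positivity) hder
    _ < (‖ψ 0‖ + M + 1) * η * 2 := by nlinarith [norm_nonneg (ψ 0)]
    _ = ε := by rw [hη]; field_simp

/-- The image of the closed unit ball is itself compact: that ball is compact for pointwise
convergence, and on it T is continuous from pointwise to norm convergence. -/
lemma IsWeightedComp.isCompactOperator_of_boundary (hT : IsWeightedComp ψ φ T)
    (hψ : DifferentiableOn ℂ ψ (unitBall n)) (hφ : DifferentiableOn ℂ φ (unitBall n))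
    (hmaps : Set.MapsTo φ (unitBall n) (unitBall n))
    (hb₁ : Tendsto (fun z => ‖ψ z‖ₑ * bigT φ z) (boundaryFilter φ) (𝓝 0))
    (hb₂ : Tendsto (fun z => blochQ ψ z *
      ENNReal.ofReal (Real.log ((1 + ‖φ z‖) / (1 - ‖φ z‖)))) (boundaryFilter φ) (𝓝 0)) :
    IsCompactOperator T := by
  refine ⟨T '' Metric.closedBall 0 1, ?_, Filter.mem_of_superset
    (Metric.closedBall_mem_nhds 0 one_pos) (Set.subset_preimage_image _ _)⟩
  refine isCompact_iff_ultrafilter_le_nhds.mpr fun U hU => ?_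
  have hU' : T '' Metric.closedBall 0 1 ∈ U := le_principal_iff.mp hU
  -- The ultrafilter on the image is lifted to one on the unit ball, where a pointwise limit g
  -- exists.
  set G := Ultrafilter.ofComapInfPrincipal hU' with hGdef
  have hG1 : ∀ᶠ f in (G : Filter (BlochSpace n)), ‖f‖ ≤ 1 :=
    Filter.mem_of_superset (Ultrafilter.ofComapInfPrincipal_mem hU') fun f hf =>
      mem_closedBall_zero_iff.mp hf
  obtain ⟨g, hg1, hg⟩ := exists_bloch_limit G hG1
  refine ⟨T g, ⟨g, by simpa using hg1, rfl⟩, ?_⟩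
  have h1 : Tendsto (fun f => T (f - g)) G (𝓝 0) := by
    refine hT.tendsto_zero_of_boundary hψ hφ hmaps hb₁ hb₂ (F := fun f => f - g) zero_le_two
      (hG1.mono fun f hf => ?_) fun x hx => ?_
    · linarith [norm_sub_le f g]
    · have := (hg x hx).sub_const (g x)
      rwa [sub_self] at this
  have h2 : Tendsto T G (𝓝 (T g)) := by
    have := h1.add_const (T g)
    simpa using this
  have h3 : G.map T = U := Ultrafilter.ofComapInfPrincipal_eq_of_map hU'
  rw [← h3]
  exact h2

end Compact

end BlochBall

/-! ### The two equivalences -/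

theorem theorem5p2 (n : ℕ) (ψ : BlochBall.Cn n → ℂ) (φ : BlochBall.Cn n → BlochBall.Cn n)
    (hψ : DifferentiableOn ℂ ψ (BlochBall.unitBall n))
    (hφ : DifferentiableOn ℂ φ (BlochBall.unitBall n))
    (hmaps : Set.MapsTo φ (BlochBall.unitBall n) (BlochBall.unitBall n)) :
    (BlochBall.IsBoundedWeightedComp ψ φ ↔
      BlochBall.IsBloch ψ ∧ BlochBall.sigma ψ φ < ∞ ∧ BlochBall.tau ψ φ < ∞) ∧
    (∀ T : BlochBall.BlochSpace n →L[ℂ] BlochBall.BlochSpace n, BlochBall.IsWeightedComp ψ φ T →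
      (IsCompactOperator T ↔
        Tendsto (fun z => ‖ψ z‖ₑ * BlochBall.bigT φ z) (BlochBall.boundaryFilter φ) (𝓝 0) ∧
        Tendsto (fun z => BlochBall.blochQ ψ z *
            ENNReal.ofReal (Real.log ((1 + ‖φ z‖) / (1 - ‖φ z‖))))
          (BlochBall.boundaryFilter φ) (𝓝 0))) := by
  refine ⟨⟨?_, fun ⟨h1, h2, h3⟩ =>
    BlochBall.isBoundedWeightedComp_of_lt_top h1 hφ hmaps h2 h3⟩, fun T hT => ⟨fun hc => ?_,
    fun ⟨h1, h2⟩ => hT.isCompactOperator_of_boundary hψ hφ hmaps h1 h2⟩⟩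
  · rintro ⟨T, hT⟩
    exact ⟨hT.isBloch hψ hmaps, hT.sigma_lt_top hψ hφ hmaps, hT.tau_lt_top hψ hφ hmaps⟩
  · exact ⟨hT.tendsto_enorm_mul_bigT hψ hφ hmaps hc, hT.tendsto_blochQ_mul_log hψ hφ hmaps hc⟩
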